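/- All graphs are finite, simple, undirected and connected. Let $G\le \mathrm{Aut}(\Gamma)$. We say that $\Gamma$ is $G$-arc-transitive if $G$ is transitive on the ordered pairs of adjacent vertices of $\Gamma$. For a vertex $v$, let $G_v$ be its stabiliser in $G$ and let $G_v^{\Gamma(v)}$ be the permutation group that $G_v$ induces on the neighbourhood $\Gamma(v)$; $G$ is locally $L$ if $G_v^{\Gamma(v)}$ is permutation isomorphic to $L$ for every $v$. A permutation group is quasiprimitive if all its non-trivial normal subgroups are transitive. A transitive permutation group $L$ is graph-restrictive with constant $c(L)$ if $|G_v|\le c(L)$ for every vertex $v$ whenever $G$ is an arc-transitive, locally $L$ group of automorphisms of a graph $\Gamma$. For $N\le G$, the quotient graph $\Gamma/N$ has the $N$-orbits on $V(\Gamma)$ as vertices, two different orbits being adjacent if there is an edge of $\Gamma$ between them; the projection $\Gamma\to\Gamma/N$ is a regular covering projection if it maps the neighbourhood of every vertex $v$ bijectively onto the neighbourhood of the orbit of $v$. A permutation group is semiregular if all its point stabilisers are trivial. $C_n$ and $D_n$ denote the cyclic group of order $n$ and the dihedral group of order $2n$; as permutation groups they are taken in their natural actions on $n$ points. **Theorem.**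 Let $L$ be a quasiprimitive, graph-restrictive permutation group of degree $d\ge 3$ with constant $c(L)$, let $k$ be a positive integer, and let $p$ be a prime with $p\ge k\,c(L)$. Suppose that $\Gamma$ is a $G$-arc-transitive graph of order $kp^\alpha$ with $\alpha\in\{1,2\}$, that $G$ is locally $L$, and that $P$ is a Sylow $p$-subgroup of $G$. Then the following hold. (a) $P$ is normal in $G$, has order $p^\alpha$, and acts semiregularly on $V(\Gamma)$. (b) If $k\ge 3$, $\bar\Gamma=\Gamma/P$ and $\bar G=G/P$, then the natural projection $\Gamma\to\bar\Gamma$ is a regular covering projection, $\bar\Gamma$ has order $k$, and $\bar G$, in its natural action on the $P$-orbits, is (faithfully) an arc-transitive and locally $L$ group of automorphisms of $\bar\Gamma$. (c) For every vertex $v$, the stabiliser $G_v$ is isomorphic to a subgroup of $\mathrm{Aut}(P)$. (d) The degree $d$ is prime, and one of the following holds, with $\bar G=G/P$: (i) $P$ is cyclic, $p\equiv 1 \pmod{2d}$, $G_v^{\Gamma(v)}\cong C_d$ (as permutation groups) for every vertex $v$, $|\bar G|=kd$, and $\bar G/[\bar G,\bar G]\cong C_{2d}$; (ii) $\alpha=2$,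 $P$ is elementary abelian of order $p^2$, and either $G_v^{\Gamma(v)}\cong C_d$ for every vertex $v$, or $G_v^{\Gamma(v)}\cong D_d$ for every vertex $v$ (as permutation groups). -/

import Mathlib

universe u w

/-- Two permutation groups `H` on `α` and `L` on `β` are permutation isomorphic: some bijection
`e : α ≃ β` carries `H` onto `L`. -/
def IsPermIso {α : Type*} {β : Type*} (H : Subgroup (Equiv.Perm α))
    (L : Subgroup (Equiv.Perm β)) : Prop :=
  ∃ e : α ≃ β, ∀ σ : Equiv.Perm α, σ ∈ H ↔ e.permCongr σ ∈ L

/-- The cyclic group `C_n` in its natural action on `n` points (`n ≥ 1`): the translations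
of `ℤ/n`. -/
def cyclicPermGroup (n : ℕ) : Subgroup (Equiv.Perm (ZMod n)) :=
  Subgroup.closure {Equiv.addRight (1 : ZMod n)}

/-- The dihedral group `D_n` of order `2n` in its natural action on `n` points (`n ≥ 3`):
generated by the rotation `x ↦ x + 1` and the reflection `x ↦ -x` of `ℤ/n`. -/
def dihedralPermGroup (n : ℕ) : Subgroup (Equiv.Perm (ZMod n)) :=
  Subgroup.closure {Equiv.addRight (1 : ZMod n), Equiv.neg (ZMod n)}

/-- The group `G` of automorphisms of `Γ` is transitive on the arcs (ordered pairs of adjacent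
vertices) of `Γ`. -/
def IsArcTransitive {V : Type*} {Γ : SimpleGraph V} (G : Subgroup (Γ ≃g Γ)) : Prop :=
  ∀ u v u' v' : V, Γ.Adj u v → Γ.Adj u' v' → ∃ g ∈ G, g u = u' ∧ g v = v'

/-- The permutation group `G_v^{Γ(v)}` induced by the vertex stabiliser `G_v` on the
neighbourhood `Γ(v)`. -/
def localAction {V : Type*} {Γ : SimpleGraph V} (G : Subgroup (Γ ≃g Γ)) (v : V) :
    Subgroup (Equiv.Perm (Γ.neighborSet v)) where
  carrier := {σ | ∃ g ∈ G, g v = v ∧ ∀ x : Γ.neighborSet v, ((σ x : Γ.neighborSet v) : V) = g x}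
  one_mem' := ⟨1, G.one_mem, rfl, fun _ => rfl⟩
  mul_mem' := by
    rintro σ τ ⟨g, hg, hgv, hσ⟩ ⟨h, hh, hhv, hτ⟩
    refine ⟨g * h, G.mul_mem hg hh, ?_, fun x => ?_⟩
    · rw [RelIso.mul_apply, hhv, hgv]
    · rw [Equiv.Perm.mul_apply, hσ, hτ, RelIso.mul_apply]
  inv_mem' := by
    rintro σ ⟨g, hg, hgv, hσ⟩
    refine ⟨g⁻¹, G.inv_mem hg, ?_, fun x => ?_⟩
    · conv_lhs => rw [← hgv]
      exact RelIso.inv_apply_self g v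
    · apply g.injective
      rw [RelIso.apply_inv_self, ← hσ]
      exact congrArg Subtype.val (σ.apply_symm_apply x)

/-- `G` is locally `L`: for every vertex `v`, the group `G_v^{Γ(v)}` is permutation isomorphic
to `L`. -/
def IsLocally {V : Type*} {Γ : SimpleGraph V} (G : Subgroup (Γ ≃g Γ)) {Ω : Type*}
    (L : Subgroup (Equiv.Perm Ω)) : Prop :=
  ∀ v : V, IsPermIso (localAction G v) L

/-- The transitive permutation group `L` is graph-restrictive with constant `c`: every vertex
stabiliser of an arc-transitive, locally `L` group of automorphisms of a finite connected graph
has order at most `c`. -/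
def IsGraphRestrictiveWith {Ω : Type w} (L : Subgroup (Equiv.Perm Ω)) (c : ℕ) : Prop :=
  MulAction.IsPretransitive L Ω ∧
    ∀ (V : Type u) [Finite V] (Γ : SimpleGraph V), Γ.Connected →
      ∀ G : Subgroup (Γ ≃g Γ), IsArcTransitive G → IsLocally G L →
        ∀ v : V, Nat.card (MulAction.stabilizer G v) ≤ c

/-- The quotient graph `Γ/N`: its vertices are the `N`-orbits on the vertices of `Γ`, and two
different orbits are adjacent if there is an edge of `Γ` between them. -/
def orbitGraph {V : Type*} (Γ : SimpleGraph V) (N : Type*) [Group N] [MulAction N V] :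
    SimpleGraph (MulAction.orbitRel.Quotient N V) where
  Adj a b := a ≠ b ∧ ∃ x y : V, Quotient.mk _ x = a ∧ Quotient.mk _ y = b ∧ Γ.Adj x y
  symm := by
    constructor
    rintro a b ⟨hab, x, y, hx, hy, h⟩
    exact ⟨hab.symm, y, x, hy, hx, h.symm⟩
  loopless := by
    constructor
    rintro a ⟨h, _⟩
    exact h rfl

/-- The vertex `v^N` of `Γ/N`, that is, the `N`-orbit of the vertex `v`. -/
def orbitMk {V : Type*} (N : Type*) [Group N] [MulAction N V] (v : V) :
    MulAction.orbitRel.Quotient N V :=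
  Quotient.mk _ v

/-- The natural projection `Γ → Γ/N` is a regular covering projection: it maps the neighbourhood
of each vertex `v` bijectively onto the neighbourhood of `v^N`. -/
def IsRegularCovering {V : Type*} (Γ : SimpleGraph V) (N : Type*) [Group N] [MulAction N V] :
    Prop :=
  ∀ v : V, Set.BijOn (orbitMk N) (Γ.neighborSet v) ((orbitGraph Γ N).neighborSet (orbitMk N v))

/-- `G/N` is (through its natural action on the `N`-orbits, which has to be faithful) an
arc-transitive and locally `L` group of automorphisms of `Γ/N`. The equation in the second
conjunct determines `ρ`. -/
def QuotientIsArcTransitiveLocally {V : Type*} {Γ : SimpleGraph V} (G : Subgroup (Γ ≃g Γ))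
    (N : Subgroup G) [N.Normal] {Ω : Type*} (L : Subgroup (Equiv.Perm Ω)) : Prop :=
  ∃ ρ : G ⧸ N →* (orbitGraph Γ N ≃g orbitGraph Γ N),
    Function.Injective ρ ∧
    (∀ (g : G) (v : V), ρ (QuotientGroup.mk g) (orbitMk N v) = orbitMk N (g • v)) ∧
    IsArcTransitive ρ.range ∧ IsLocally ρ.range L

/-! Counting gives |G| = p^α·k·|G_v| with k|G_v| ≤ p. Equality would make |G| a power of the odd
prime p, but an arc-reversing element forces |G| to be even. So a Sylow p-subgroup P has index below
p and is normal by Sylow's congruence; it is semiregular because p does not divide |G_v|, and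
abelian because its order is p or p².

The main device is an affine action. By Schur–Zassenhaus P has a complement, so G acts on P by
affine maps, P itself by translations, and averaging gives a fixed point to every subgroup meeting P
trivially (`exists_affine_action`). Let G_v fix q, let the stabiliser of the edge {v,w} fix r, and
let t reverse the edge. Since G = ⟨G_v, t⟩, t moves q, so r ≠ q. Hence the arc stabiliser
centralises r q⁻¹ ≠ 1, and t does not centralise P. An element of G_v centralising P acts as the
identity; if the kernel of the affine action were not semiregular on vertices it would have at most
two vertex orbits, leaving two positions for q, although P has more than two elements. So G_v embeds
in Aut(P) (`eq_one_of_centralizes`).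

Next comes an x in G_v that moves a neighbour of v and is conjugate in G_v only to x and x⁻¹. If P
is cyclic, Aut(P) and hence G_v is abelian, and any x moving a neighbour works. Otherwise G_v lies
in GL(2,p), and its determinant-one part N is semiregular on Γ(v). By local quasiprimitivity N is
trivial, and then G_v is abelian, or it is minimal normal. An involution in N is −1; without
involutions N has cyclic Sylow subgroups, so it is soluble, hence abelian, and eigenvalues give the
claim.

The subgroups of ⟨x⟩ are normalised by G_v, so each is trivial or transitive on Γ(v): d is prime and
x induces a d-cycle (`exists_cycle`). This makes the local action C_d or D_d, and makes a P-orbit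
contain Γ(v) or meet it at most once, which gives the covering. For cyclic P, the images of x and t
in Aut(P), of orders d and 2, give the congruence and the abelianisation. -/

/-- The group `G` acts on the connected graph `Γ` as an arc-transitive group of automorphisms, and
every subgroup of a vertex stabiliser `G_v` that is normalised by `G_v` is either trivial or
transitive on the neighbourhood of `v`. -/
structure ActsLocallyQuasiprimitively (G : Type*) [Group G] {V : Type*} [MulAction G V]
    (Γ : SimpleGraph V) : Prop where
  connected : Γ.Connected
  smul_adj : ∀ (g : G) {u v : V}, Γ.Adj u v → Γ.Adj (g • u) (g • v)
  exists_adj : ∀ v : V, ∃ w, Γ.Adj v w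
  arc_transitive : ∀ u v u' v' : V, Γ.Adj u v → Γ.Adj u' v' → ∃ g : G, g • u = u' ∧ g • v = v'
  trivial_or_transitive : ∀ (v : V) (M : Subgroup G), (∀ m ∈ M, m • v = v) →
    (∀ g : G, g • v = v → ∀ m ∈ M, g * m * g⁻¹ ∈ M) →
    (∀ m ∈ M, ∀ w, Γ.Adj v w → m • w = w) ∨
      ∀ w w', Γ.Adj v w → Γ.Adj v w' → ∃ m ∈ M, m • w = w'

/-! ### Normal subgroups and generation in locally quasiprimitive actions -/

namespace ActsLocallyQuasiprimitively

variable {G : Type*} [Group G] {V : Type*} [MulAction G V] {Γ : SimpleGraph V}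

theorem adj_of_smul (h : ActsLocallyQuasiprimitively G Γ) (g : G) {u v : V}
    (huv : Γ.Adj (g • u) (g • v)) : Γ.Adj u v := by
  simpa using h.smul_adj g⁻¹ huv

theorem exists_smul_eq (h : ActsLocallyQuasiprimitively G Γ) (u v : V) : ∃ g : G, g • u = v := by
  obtain ⟨u', hu⟩ := h.exists_adj u
  obtain ⟨v', hv⟩ := h.exists_adj v
  obtain ⟨g, hg, -⟩ := h.arc_transitive _ _ _ _ hu hv
  exact ⟨g, hg⟩

theorem exists_stabilizer_smul_eq (h : ActsLocallyQuasiprimitively G Γ) {v w w' : V}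
    (hw : Γ.Adj v w) (hw' : Γ.Adj v w') : ∃ g : G, g • v = v ∧ g • w = w' :=
  h.arc_transitive _ _ _ _ hw hw'

theorem exists_swap (h : ActsLocallyQuasiprimitively G Γ) {v w : V} (hw : Γ.Adj v w) :
    ∃ t : G, t • v = w ∧ t • w = v :=
  h.arc_transitive _ _ _ _ hw hw.symm

/-- A set of vertices that contains a vertex and is closed under adjacency contains everything. -/
theorem mem_of_closed (h : ActsLocallyQuasiprimitively G Γ) {S : V → Prop} {v : V} (hv : S v)
    (hS : ∀ u w, S u → Γ.Adj u w → S w) (u : V) : S u := by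
  obtain ⟨q⟩ := h.connected.preconnected v u
  induction q with
  | nil => exact hv
  | cons hadj _ ih => exact ih (hS _ _ hv hadj)

theorem eq_one_of_fixes_neighbors [FaithfulSMul G V] (h : ActsLocallyQuasiprimitively G Γ) {g : G}
    (hg : ∀ u, g • u = u → ∀ w, Γ.Adj u w → g • w = w) {v : V} (hv : g • v = v) : g = 1 := by
  refine FaithfulSMul.eq_of_smul_eq_smul (α := V) fun u => ?_
  rw [one_smul]
  exact h.mem_of_closed (S := fun u => g • u = u) hv (fun u w hu => hg u hu w) u

/-- A normal subgroup is semiregular, or has all neighbours of a vertex in a single orbit. -/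
theorem semiregular_or_transitive [FaithfulSMul G V] (h : ActsLocallyQuasiprimitively G Γ)
    (N : Subgroup G) [hN : N.Normal] :
    (∀ n ∈ N, ∀ v : V, n • v = v → n = 1) ∨
      ∀ v w w', Γ.Adj v w → Γ.Adj v w' → ∃ n ∈ N, n • v = v ∧ n • w = w' := by
  have key : ∀ v, (∀ n ∈ N, n • v = v → ∀ w, Γ.Adj v w → n • w = w) ∨
      ∀ w w', Γ.Adj v w → Γ.Adj v w' → ∃ n ∈ N, n • v = v ∧ n • w = w' := by
    intro v
    have hconj : ∀ g : G, g • v = v → ∀ m ∈ N ⊓ MulAction.stabilizer G v,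
        g * m * g⁻¹ ∈ N ⊓ MulAction.stabilizer G v := by
      intro g hg m hm
      refine ⟨hN.conj_mem _ hm.1 g, ?_⟩
      have h2 : m • v = v := hm.2
      show (g * m * g⁻¹) • v = v
      rw [mul_smul, mul_smul, inv_smul_eq_iff.2 hg.symm, h2, hg]
    rcases h.trivial_or_transitive v (N ⊓ MulAction.stabilizer G v) (fun m hm => hm.2) hconj with h1 | h1
    · exact Or.inl fun n hn hnv => h1 n ⟨hn, hnv⟩
    · refine Or.inr fun w w' hw hw' => ?_
      obtain ⟨m, hm, hmw⟩ := h1 w w' hw hw'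
      exact ⟨m, hm.1, hm.2, hmw⟩
  -- Conjugation spreads local transitivity from one vertex to all. If it occurs nowhere, an element
  -- of N fixing a vertex fixes its neighbours, and so on throughout the connected graph.
  by_cases htr : ∃ v, ∀ w w', Γ.Adj v w → Γ.Adj v w' → ∃ n ∈ N, n • v = v ∧ n • w = w'
  · obtain ⟨v, hv⟩ := htr
    refine Or.inr fun u w w' hw hw' => ?_
    obtain ⟨g, rfl⟩ := h.exists_smul_eq v u
    have aux : ∀ x, Γ.Adj (g • v) x → Γ.Adj v (g⁻¹ • x) := fun x hx =>
      h.adj_of_smul g (by simpa using hx)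
    obtain ⟨n, hn, hnv, hnw⟩ := hv _ _ (aux w hw) (aux w' hw')
    refine ⟨g * n * g⁻¹, hN.conj_mem _ hn g, ?_, ?_⟩
    · simp [mul_smul, hnv]
    · rw [mul_smul, mul_smul, hnw, smul_inv_smul]
  · refine Or.inl fun n hn v hv => h.eq_one_of_fixes_neighbors (fun u hu => ?_) hv
    exact (key u).resolve_right (fun h2 => htr ⟨u, h2⟩) n hn hu

/-- If the neighbours of `v` are in one orbit of the normal subgroup `N`, then `N` has at most
two orbits. -/
theorem mem_orbit_or_mem_orbit (h : ActsLocallyQuasiprimitively G Γ) {N : Subgroup G}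
    [hN : N.Normal] {v w : V} (hvw : Γ.Adj v w) (hw : ∀ w', Γ.Adj v w' → ∃ n ∈ N, n • w = w')
    (u : V) : ∃ n ∈ N, n • v = u ∨ n • w = u := by
  obtain ⟨t, htv, htw⟩ := h.exists_swap hvw
  refine h.mem_of_closed (S := fun u => ∃ n ∈ N, n • v = u ∨ n • w = u) (v := v)
    ⟨1, N.one_mem, Or.inl (one_smul _ _)⟩ ?_ u
  rintro x y ⟨n, hn, hx⟩ hxy
  have hxy' : Γ.Adj (n⁻¹ • x) (n⁻¹ • y) := h.smul_adj _ hxy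
  rcases hx with rfl | rfl
  · rw [inv_smul_smul] at hxy'
    obtain ⟨m, hm, hmw⟩ := hw _ hxy'
    exact ⟨n * m, N.mul_mem hn hm, Or.inr (by rw [mul_smul, hmw, smul_inv_smul])⟩
  · rw [inv_smul_smul, ← htv] at hxy'
    have h2 : Γ.Adj v (t⁻¹ • n⁻¹ • y) := h.adj_of_smul t (by simpa using hxy')
    obtain ⟨m, hm, hmw⟩ := hw _ h2
    refine ⟨n * (t * m * t⁻¹), N.mul_mem hn (hN.conj_mem _ hm t), Or.inl ?_⟩
    rw [mul_smul, mul_smul, mul_smul, inv_smul_eq_iff.2 htw.symm, hmw, smul_inv_smul, smul_inv_smul]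

/-- A vertex stabiliser and an element reversing an arc generate the group. -/
theorem eq_top_of_stabilizer_le (h : ActsLocallyQuasiprimitively G Γ) {H : Subgroup G} {v w : V}
    (hvw : Γ.Adj v w) {t : G} (htv : t • v = w)
    (hH : ∀ g : G, g • v = v → g ∈ H) (ht : t ∈ H) : H = ⊤ := by
  have horb : ∀ u, ∃ g ∈ H, g • v = u := by
    refine h.mem_of_closed (S := fun u => ∃ g ∈ H, g • v = u) ⟨1, H.one_mem, one_smul _ v⟩ ?_
    rintro x y ⟨g, hg, rfl⟩ hxy
    have h2 : Γ.Adj v (g⁻¹ • y) := h.adj_of_smul g (by simpa using hxy)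
    obtain ⟨s, hsv, hsw⟩ := h.exists_stabilizer_smul_eq hvw h2
    refine ⟨g * s * t, H.mul_mem (H.mul_mem hg (hH s hsv)) ht, ?_⟩
    rw [mul_smul, mul_smul, htv, hsw, smul_inv_smul]
  refine (Subgroup.eq_top_iff' H).2 fun g => ?_
  obtain ⟨k, hk, hkv⟩ := horb (g • v)
  have : k⁻¹ * g ∈ H := hH _ (by rw [mul_smul, ← hkv, inv_smul_smul])
  simpa using H.mul_mem hk this

end ActsLocallyQuasiprimitively

/-! ### The affine action on an abelian normal Hall subgroup -/

/-- A normal commutative subgroup `P` of a finite group with order coprime to its index has a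
crossed homomorphism onto it that is the identity on `P`. -/
theorem exists_crossedHom {G : Type*} [Group G] {P : Subgroup G} [P.Normal]
    [IsMulCommutative P] (hP : (Nat.card P).Coprime P.index) :
    ∃ c : G → P, (∀ g h, c (g * h) = c g * MulAut.conjNormal g (c h)) ∧ ∀ x : P, c x = x := by
  obtain ⟨H, hH⟩ := Subgroup.exists_right_complement'_of_coprime hP
  -- In the factorisation G = PH, the value of the crossed homomorphism at g is the P-component of
  -- g.
  have hex : ∀ g : G, ∃ x : P, (x : G)⁻¹ * g ∈ H := fun g => by
    obtain ⟨⟨x, y⟩, hxy⟩ := hH.2 g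
    refine ⟨x, ?_⟩
    rw [← hxy]
    simp
  have huniq : ∀ (g : G) (x y : P), (x : G)⁻¹ * g ∈ H → (y : G)⁻¹ * g ∈ H → x = y := by
    intro g x y hx hy
    have h1 : ((x⁻¹ * y : P) : G) ∈ H := by
      have := H.mul_mem hx (H.inv_mem hy)
      simpa [mul_assoc] using this
    have h2 := Subgroup.disjoint_def.1 hH.disjoint (x⁻¹ * y : P).2 h1
    have h3 : (x⁻¹ * y : P) = 1 := Subtype.ext h2
    exact inv_mul_eq_one.1 h3
  choose c hc using hex
  refine ⟨c, fun g h => huniq (g * h) _ _ (hc _) ?_, fun x => huniq x _ _ (hc _) ?_⟩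
  · have hcomm : (c g * MulAut.conjNormal g (c h) : P) = MulAut.conjNormal g (c h) * c g :=
      mul_comm' _ _
    have h2 : ((c g * MulAut.conjNormal g (c h) : P) : G)⁻¹ * (g * h) =
        ((c g : G)⁻¹ * g) * ((c h : G)⁻¹ * h) := by
      rw [hcomm]
      simp [mul_assoc]
    rw [h2]
    exact H.mul_mem (hc g) (hc h)
  · simp

/-- A crossed homomorphism into a commutative group is principal on a finite subgroup of
coprime order. -/
theorem exists_fixed_of_crossedHom {G A : Type*} [Group G] [CommGroup A] (φ : G →* MulAut A)
    (c : G → A) (hc : ∀ g h, c (g * h) = c g * φ g (c h)) (K : Subgroup G) [Finite K]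
    (hK : (Nat.card K).Coprime (Nat.card A)) : ∃ u : A, ∀ g ∈ K, c g * φ g u = u := by
  classical
  have := Fintype.ofFinite K
  set s : A := ∏ h : K, c h with hs
  -- Left translation by g permutes K, so the product s of all values satisfies the
  -- crossed-homomorphism identity summed over K. Then u is obtained by extracting the |K|-th root
  -- of s, which is unique by coprimality.
  have h1 : ∀ g ∈ K, s = c g ^ Nat.card K * φ g s := by
    intro g hg
    calc s = ∏ h : K, c ((⟨g, hg⟩ * h : K) : G) :=
          (Equiv.prod_comp (Equiv.mulLeft (⟨g, hg⟩ : K)) fun h : K => c h).symm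
      _ = ∏ h : K, c g * φ g (c h) := Finset.prod_congr rfl fun h _ => by
          rw [Subgroup.coe_mul, hc]
      _ = c g ^ Nat.card K * φ g s := by
          rw [Finset.prod_mul_distrib, Finset.prod_const, hs, map_prod, Finset.card_univ,
            Nat.card_eq_fintype_card]
  have hbij := (powCoprime hK.symm : A ≃ A).surjective
  have hinj := (powCoprime hK.symm : A ≃ A).injective
  obtain ⟨u, hu⟩ := hbij s
  refine ⟨u, fun g hg => hinj ?_⟩
  have hu' : u ^ Nat.card K = s := hu
  show (c g * φ g u) ^ Nat.card K = u ^ Nat.card K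
  rw [mul_pow, ← map_pow, hu', ← h1 g hg]

/-- A finite group `G` with a commutative normal Hall subgroup `P` acts on `P` by affine maps, with
`P` acting by translations, and subgroups of coprime order have fixed points. -/
theorem exists_affine_action {G : Type*} [Group G] [Finite G] {P : Subgroup G} [P.Normal]
    [IsMulCommutative P] (hP : (Nat.card P).Coprime P.index) :
    ∃ A : G →* Equiv.Perm P, (∀ g x u, A g (x * u) = MulAut.conjNormal g x * A g u) ∧
      (∀ x u : P, A x u = x * u) ∧
      ∀ K : Subgroup G, K ⊓ P = ⊥ → ∃ u, ∀ g ∈ K, A g u = u := by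
  obtain ⟨c, hc, hcP⟩ := exists_crossedHom hP
  have hc1 : c 1 = 1 := hcP 1
  let B : G →* Function.End P :=
    { toFun := fun g u => c g * MulAut.conjNormal g u
      map_one' := by
        funext u
        show c 1 * MulAut.conjNormal 1 u = u
        rw [hc1, map_one, one_mul, MulAut.one_apply]
      map_mul' := fun g h => by
        funext u
        show c (g * h) * MulAut.conjNormal (g * h) u =
          c g * MulAut.conjNormal g (c h * MulAut.conjNormal h u)
        rw [hc, map_mul, map_mul, MulAut.mul_apply, mul_assoc] }
  have hA : ∀ g u, B.toHomPerm g u = c g * MulAut.conjNormal g u := fun _ _ => rfl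
  refine ⟨B.toHomPerm, fun g x u => ?_, fun x u => ?_, fun K hK => ?_⟩
  · rw [hA, hA, map_mul, ← mul_assoc, mul_comm' (c g), mul_assoc]
  · rw [hA, hcP]
    congr 1
    ext
    rw [MulAut.conjNormal_apply, ← Subgroup.coe_mul, mul_comm' x u]
    simp
  · let _ : CommGroup P := IsMulCommutative.instCommGroup
    refine exists_fixed_of_crossedHom MulAut.conjNormal c hc K ?_
    have hinj : Function.Injective ((QuotientGroup.mk' P).comp K.subtype) := by
      rw [injective_iff_map_eq_one]
      intro k hk
      have h1 : (k : G) ∈ P := (QuotientGroup.eq_one_iff (k : G)).1 hk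
      have h2 : (k : G) ∈ K ⊓ P := ⟨k.2, h1⟩
      rw [hK] at h2
      exact Subtype.ext h2
    exact (hP.coprime_dvd_right (Subgroup.card_dvd_of_injective _ hinj)).symm

theorem eq_one_of_mul_self_of_odd_card {G : Type*} [Group G] (hG : Odd (Nat.card G)) {x : G}
    (hx : x * x = 1) : x = 1 := by
  have h1 : orderOf x ∣ 2 := orderOf_dvd_of_pow_eq_one (by rw [pow_two, hx])
  have h2 : orderOf x ∣ Nat.card G := orderOf_dvd_natCard x
  have h3 : orderOf x ∣ 1 := by
    rw [← (Nat.coprime_two_left.2 hG : Nat.gcd 2 _ = 1)]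
    exact Nat.dvd_gcd h1 h2
  exact orderOf_eq_one_iff.1 (Nat.dvd_one.1 h3)

/-! ### Fixed points of vertex and edge stabilisers -/

namespace ActsLocallyQuasiprimitively

variable {G : Type*} [Group G] [Finite G] {V : Type*} [MulAction G V] {Γ : SimpleGraph V}
  {P : Subgroup G} [P.Normal] [IsMulCommutative P]

/-- The common setting of the next results: a vertex stabiliser fixes a point of the affine
action on `P` and so does the edge stabiliser, and these points differ. -/
theorem exists_affine_action_fixing (h : ActsLocallyQuasiprimitively G Γ)
    (hP : (Nat.card P).Coprime P.index) (hodd : Odd (Nat.card P)) (hne : P ≠ ⊥)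
    (hsemi : ∀ x ∈ P, ∀ v : V, x • v = v → x = 1) {v w : V} (hvw : Γ.Adj v w) {t : G}
    (htv : t • v = w) (htw : t • w = v) :
    ∃ (A : G →* Equiv.Perm P) (q r : P), (∀ g x u, A g (x * u) = MulAut.conjNormal g x * A g u) ∧
      (∀ x u : P, A x u = x * u) ∧ (∀ g : G, g • v = v → A g q = q) ∧ A t q ≠ q ∧
      (∀ g : G, g • v = v → g • w = w → A g r = r) ∧ A t r = r := by
  obtain ⟨A, hA, hAP, hfix⟩ := exists_affine_action hP
  obtain ⟨q, hq⟩ := hfix (MulAction.stabilizer G v) (by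
    rw [eq_bot_iff]
    exact fun g hg => hsemi g hg.2 v hg.1)
  -- The setwise stabiliser of the edge. It meets P trivially: an element of P swapping v and w has
  -- its square fixing v, so it is an involution in a group of odd order.
  let E : Subgroup G :=
    { carrier := {g | (g • v = v ∧ g • w = w) ∨ (g • v = w ∧ g • w = v)}
      one_mem' := Or.inl ⟨one_smul _ _, one_smul _ _⟩
      mul_mem' := by
        rintro a b (⟨h1, h2⟩ | ⟨h1, h2⟩) (⟨h3, h4⟩ | ⟨h3, h4⟩) <;>
          simp [mul_smul, h1, h2, h3, h4]
      inv_mem' := by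
        rintro a (⟨h1, h2⟩ | ⟨h1, h2⟩)
        · exact Or.inl ⟨inv_smul_eq_iff.2 h1.symm, inv_smul_eq_iff.2 h2.symm⟩
        · exact Or.inr ⟨inv_smul_eq_iff.2 h2.symm, inv_smul_eq_iff.2 h1.symm⟩ }
  obtain ⟨r, hr⟩ := hfix E (by
    rw [eq_bot_iff]
    rintro g ⟨hgE, hgP⟩
    rcases hgE with ⟨h1, -⟩ | ⟨h1, h2⟩
    · exact hsemi g hgP v h1
    · have h3 : g * g = 1 := hsemi _ (P.mul_mem hgP hgP) v (by rw [mul_smul, h1, h2])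
      have h4 : (⟨g, hgP⟩ : P) = 1 :=
        eq_one_of_mul_self_of_odd_card hodd (Subtype.ext h3)
      exact congrArg Subtype.val h4)
  refine ⟨A, q, r, hA, hAP, fun g hg => hq g hg, fun htq => hne ?_,
    fun g h1 h2 => hr g (Or.inl ⟨h1, h2⟩), hr t (Or.inr ⟨htv, htw⟩)⟩
  have htop := h.eq_top_of_stabilizer_le (H := (MulAction.stabilizer (Equiv.Perm P) q).comap A)
    hvw htv (fun g hg => hq g hg) htq
  rw [eq_bot_iff]
  intro x hx
  have hx' : x ∈ (MulAction.stabilizer (Equiv.Perm P) q).comap A := htop ▸ Subgroup.mem_top x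
  have h1 : A x q = q := hx'
  have h2 := hAP ⟨x, hx⟩ q
  rw [h1] at h2
  exact congrArg Subtype.val (right_eq_mul.1 h2)

/-- An arc stabiliser centralises a non-trivial element of `P`. -/
theorem exists_commute_of_fixes_arc (h : ActsLocallyQuasiprimitively G Γ)
    (hP : (Nat.card P).Coprime P.index) (hodd : Odd (Nat.card P)) (hne : P ≠ ⊥)
    (hsemi : ∀ x ∈ P, ∀ v : V, x • v = v → x = 1) {v w : V} (hvw : Γ.Adj v w) :
    ∃ x : P, x ≠ 1 ∧ ∀ g : G, g • v = v → g • w = w → MulAut.conjNormal g x = x := by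
  obtain ⟨t, htv, htw⟩ := h.exists_swap hvw
  obtain ⟨A, q, r, hA, -, hq, htq, hr, htr⟩ :=
    h.exists_affine_action_fixing hP hodd hne hsemi hvw htv htw
  refine ⟨r * q⁻¹, fun h1 => htq ?_, fun g hgv hgw => ?_⟩
  · rwa [← mul_inv_eq_one.1 h1]
  · have h1 := hA g (r * q⁻¹) q
    rw [inv_mul_cancel_right, hr g hgv hgw, hq g hgv] at h1
    exact (mul_inv_eq_of_eq_mul h1).symm

/-- An element reversing an arc does not centralise `P`. -/
theorem not_centralizes_of_swap (h : ActsLocallyQuasiprimitively G Γ)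
    (hP : (Nat.card P).Coprime P.index) (hodd : Odd (Nat.card P)) (hne : P ≠ ⊥)
    (hsemi : ∀ x ∈ P, ∀ v : V, x • v = v → x = 1) {v w : V} (hvw : Γ.Adj v w) {t : G}
    (htv : t • v = w) (htw : t • w = v) : MulAut.conjNormal (H := P) t ≠ 1 := by
  intro ht
  obtain ⟨A, q, r, hA, -, -, htq, -, htr⟩ :=
    h.exists_affine_action_fixing hP hodd hne hsemi hvw htv htw
  have h1 := hA t (q * r⁻¹) r
  rw [inv_mul_cancel_right, htr, ht, MulAut.one_apply, inv_mul_cancel_right] at h1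
  exact htq h1

/-- A vertex stabiliser acts faithfully on `P`. -/
theorem eq_one_of_centralizes [FaithfulSMul G V] (h : ActsLocallyQuasiprimitively G Γ)
    (hP : (Nat.card P).Coprime P.index) (hodd : Odd (Nat.card P)) (hne : P ≠ ⊥)
    (hsemi : ∀ x ∈ P, ∀ v : V, x • v = v → x = 1) {v : V} {g : G} (hgv : g • v = v)
    (hg : MulAut.conjNormal (H := P) g = 1) : g = 1 := by
  obtain ⟨w, hvw⟩ := h.exists_adj v
  obtain ⟨t, htv, htw⟩ := h.exists_swap hvw
  obtain ⟨A, q, r, hA, hAP, hq, -, -, -⟩ :=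
    h.exists_affine_action_fixing hP hodd hne hsemi hvw htv htw
  -- The linear part of g is trivial, so g acts as a translation; fixing q, it is the identity.
  have hgA : g ∈ A.ker := by
    rw [MonoidHom.mem_ker]
    ext1 u
    have h1 := hA g (u * q⁻¹) q
    rwa [inv_mul_cancel_right, hg, hq g hgv, MulAut.one_apply, inv_mul_cancel_right] at h1
  rcases h.semiregular_or_transitive A.ker with h1 | h1
  · exact h1 g hgA v hgv
  exfalso
  -- The image of q under an element depends only on the `A.ker`-orbit to which that element sends
  -- v. There are at most two such orbits, represented by v and t • v = w, so P would have at most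
  -- two elements.
  have h2 : ∀ x : P, x * q = q ∨ x * q = A t q := by
    intro x
    have aux : ∀ n ∈ A.ker, ∀ s : G, n • s • v = (x : G) • v → x * q = A s q := by
      intro n hn s hs
      have h3 := hq (s⁻¹ * n⁻¹ * x) (by
        rw [mul_smul, mul_smul, ← hs, inv_smul_smul, inv_smul_smul])
      rw [map_mul, map_mul, map_inv, map_inv, MonoidHom.mem_ker.1 hn, inv_one, mul_one,
        Equiv.Perm.mul_apply, hAP, Equiv.Perm.inv_eq_iff_eq] at h3
      exact h3
    obtain ⟨n, hn, hnv⟩ := h.mem_orbit_or_mem_orbit (N := A.ker) hvw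
      (fun w' hw' => by
        obtain ⟨n, hn, -, hnw⟩ := h1 v w w' hvw hw'
        exact ⟨n, hn, hnw⟩) ((x : G) • v)
    rcases hnv with hnv | hnv
    · left
      simpa using aux n hn 1 (by rw [one_smul, hnv])
    · right
      exact aux n hn t (by rw [htv, hnv])
  obtain ⟨y, hy1⟩ := Subgroup.ne_bot_iff_exists_ne_one.1 hne
  have hy : y * y ≠ 1 := fun h => hy1 (eq_one_of_mul_self_of_odd_card hodd h)
  have h3 := (h2 y).resolve_left (fun h => hy1 (mul_eq_right.1 h))
  have h4 := (h2 (y * y)).resolve_left (fun h => hy (mul_eq_right.1 h))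
  have h5 := mul_right_cancel (h4.trans h3.symm)
  exact hy1 (mul_eq_left.1 h5)

end ActsLocallyQuasiprimitively

/-! ### Cyclic and dihedral permutation groups -/

theorem addRight_one_zpow_apply {n : ℕ} (k : ℤ) (i : ZMod n) :
    ((Equiv.addRight (1 : ZMod n)) ^ k) i = i + k := by
  induction k using Int.induction_on generalizing i with
  | zero => simp
  | succ k ih => rw [zpow_add_one, Equiv.Perm.mul_apply, ih]; simp; ring
  | pred k ih =>
    rw [zpow_sub_one, Equiv.Perm.mul_apply, ih]
    simp [Equiv.Perm.inv_def]; ring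

theorem mem_cyclicPermGroup {n : ℕ} {τ : Equiv.Perm (ZMod n)} :
    τ ∈ cyclicPermGroup n ↔ ∃ j, ∀ i, τ i = i + j := by
  rw [cyclicPermGroup, Subgroup.mem_closure_singleton]
  constructor
  · rintro ⟨k, rfl⟩
    exact ⟨k, addRight_one_zpow_apply k⟩
  · rintro ⟨j, hj⟩
    obtain ⟨k, rfl⟩ := ZMod.intCast_surjective j
    exact ⟨k, Equiv.ext fun i => (addRight_one_zpow_apply k i).trans (hj i).symm⟩

theorem mem_dihedralPermGroup {n : ℕ} {τ : Equiv.Perm (ZMod n)} :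
    τ ∈ dihedralPermGroup n ↔ ∃ j, (∀ i, τ i = i + j) ∨ ∀ i, τ i = -i + j := by
  have hle : cyclicPermGroup n ≤ dihedralPermGroup n := Subgroup.closure_mono (by simp)
  constructor
  · intro hτ
    let D : Subgroup (Equiv.Perm (ZMod n)) :=
      { carrier := {τ | ∃ j, (∀ i, τ i = i + j) ∨ ∀ i, τ i = -i + j}
        one_mem' := ⟨0, Or.inl fun i => by simp⟩
        mul_mem' := by
          rintro a b ⟨j, hj | hj⟩ ⟨k, hk | hk⟩
          · exact ⟨k + j, Or.inl fun i => by rw [Equiv.Perm.mul_apply, hj, hk]; ring⟩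
          · exact ⟨k + j, Or.inr fun i => by rw [Equiv.Perm.mul_apply, hj, hk]; ring⟩
          · exact ⟨-k + j, Or.inr fun i => by rw [Equiv.Perm.mul_apply, hj, hk]; ring⟩
          · exact ⟨-k + j, Or.inl fun i => by rw [Equiv.Perm.mul_apply, hj, hk]; ring⟩
        inv_mem' := by
          rintro a ⟨j, hj | hj⟩
          · exact ⟨-j, Or.inl fun i => by rw [Equiv.Perm.inv_eq_iff_eq, hj]; ring⟩
          · exact ⟨j, Or.inr fun i => by rw [Equiv.Perm.inv_eq_iff_eq, hj]; ring⟩ }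
    refine (Subgroup.closure_le D).2 ?_ hτ
    rintro σ (rfl | rfl)
    · exact ⟨1, Or.inl fun i => rfl⟩
    · exact ⟨0, Or.inr fun i => by simp⟩
  · rintro ⟨j, hj | hj⟩
    · exact hle (mem_cyclicPermGroup.2 ⟨j, hj⟩)
    · have h1 : τ = Equiv.addRight j * Equiv.neg (ZMod n) := Equiv.ext fun i => by simp [hj]
      rw [h1]
      exact Subgroup.mul_mem _ (hle (mem_cyclicPermGroup.2 ⟨j, fun i => rfl⟩))
        (Subgroup.subset_closure (by simp))

section

variable {X : Type*} {n : ℕ} {R : Subgroup (Equiv.Perm X)} (e : ZMod n ≃ X) {r : Equiv.Perm X}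

theorem rotation_zpow_apply (hr : ∀ i, r (e i) = e (i + 1)) (k : ℤ) (i : ZMod n) :
    (r ^ k) (e i) = e (i + k) := by
  have h1 : r = e.permCongr (Equiv.addRight 1) := Equiv.ext fun x => by
    obtain ⟨i, rfl⟩ := e.surjective x
    simp [hr]
  have h2 : r ^ k = e.permCongr (Equiv.addRight 1 ^ k) := by
    rw [h1]
    exact (map_zpow e.permCongrHom _ k).symm
  simp [h2]

/-- Multiplying by a power of the rotation `r` reduces any element of `R` to one fixing `e 0`, where
`hs` decides. The dihedral version works in the same way. -/
theorem isPermIso_cyclicPermGroup (hrR : r ∈ R) (hr : ∀ i, r (e i) = e (i + 1))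
    (hs : ∀ σ ∈ R, σ (e 0) = e 0 → ∀ i, σ (e i) = e i) : IsPermIso R (cyclicPermGroup n) := by
  refine ⟨e.symm, fun σ => ?_⟩
  rw [mem_cyclicPermGroup]
  simp only [Equiv.permCongr_apply, Equiv.symm_symm, Equiv.symm_apply_eq]
  constructor
  · intro hσ
    obtain ⟨j, hj⟩ := e.surjective (σ (e 0))
    obtain ⟨k, rfl⟩ := ZMod.intCast_surjective j
    refine ⟨k, fun i => ?_⟩
    have h1 := hs (r ^ (-k) * σ) (R.mul_mem (R.zpow_mem hrR _) hσ) (by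
      rw [Equiv.Perm.mul_apply, ← hj, rotation_zpow_apply e hr]; simp) i
    rw [Equiv.Perm.mul_apply, zpow_neg, Equiv.Perm.inv_eq_iff_eq, rotation_zpow_apply e hr] at h1
    exact h1
  · rintro ⟨j, hj⟩
    obtain ⟨k, rfl⟩ := ZMod.intCast_surjective j
    have h1 : σ = r ^ k := Equiv.ext fun x => by
      obtain ⟨i, rfl⟩ := e.surjective x
      rw [hj, rotation_zpow_apply e hr]
    exact h1 ▸ R.zpow_mem hrR k

theorem isPermIso_dihedralPermGroup (hrR : r ∈ R) (hr : ∀ i, r (e i) = e (i + 1))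
    (hs : ∀ σ ∈ R, σ (e 0) = e 0 → (∀ i, σ (e i) = e i) ∨ ∀ i, σ (e i) = e (-i))
    {s : Equiv.Perm X} (hsR : s ∈ R) (hse : ∀ i, s (e i) = e (-i)) :
    IsPermIso R (dihedralPermGroup n) := by
  refine ⟨e.symm, fun σ => ?_⟩
  rw [mem_dihedralPermGroup]
  simp only [Equiv.permCongr_apply, Equiv.symm_symm, Equiv.symm_apply_eq]
  constructor
  · intro hσ
    obtain ⟨j, hj⟩ := e.surjective (σ (e 0))
    obtain ⟨k, rfl⟩ := ZMod.intCast_surjective j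
    refine ⟨k, ?_⟩
    have h1 := hs (r ^ (-k) * σ) (R.mul_mem (R.zpow_mem hrR _) hσ) (by
      rw [Equiv.Perm.mul_apply, ← hj, rotation_zpow_apply e hr]; simp)
    simpa only [Equiv.Perm.mul_apply, zpow_neg, Equiv.Perm.inv_eq_iff_eq,
      rotation_zpow_apply e hr] using h1
  · rintro ⟨j, hj⟩
    obtain ⟨k, rfl⟩ := ZMod.intCast_surjective j
    rcases hj with hj | hj
    · have h1 : σ = r ^ k := Equiv.ext fun x => by
        obtain ⟨i, rfl⟩ := e.surjective x
        rw [hj, rotation_zpow_apply e hr]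
      exact h1 ▸ R.zpow_mem hrR k
    · have h1 : σ = r ^ k * s := Equiv.ext fun x => by
        obtain ⟨i, rfl⟩ := e.surjective x
        rw [hj, Equiv.Perm.mul_apply, hse, rotation_zpow_apply e hr]
      exact h1 ▸ R.mul_mem (R.zpow_mem hrR k) hsR

end

/-! ### Cycles of prime length on a neighbourhood -/

namespace ActsLocallyQuasiprimitively

variable {G : Type*} [Group G] {V : Type*} [MulAction G V] {Γ : SimpleGraph V}

/-- An element of a vertex stabiliser generating a normal subgroup that is non-trivial on the
neighbourhood permutes the neighbours in a cycle of prime length. -/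
theorem exists_cycle [Finite V] (h : ActsLocallyQuasiprimitively G Γ) {v w : V} (hvw : Γ.Adj v w)
    {x : G} (hxv : x • v = v) (hxw : x • w ≠ w)
    (hx : ∀ g : G, g • v = v → g * x * g⁻¹ = x ∨ g * x * g⁻¹ = x⁻¹) :
    (Nat.card (Γ.neighborSet v)).Prime ∧
      ∃ e : ZMod (Nat.card (Γ.neighborSet v)) ≃ Γ.neighborSet v,
        ∀ k : ℤ, (e k : V) = x ^ k • w := by
  -- G_v normalises ⟨x^q⟩ because it sends x to x or x⁻¹; so ⟨x^q⟩ is transitive as soon as it moves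
  -- w.
  have htrans : ∀ q : ℕ, x ^ q • w ≠ w → ∀ w', Γ.Adj v w' → ∃ k : ℤ, (x ^ q) ^ k • w = w' := by
    intro q hq
    have hM : ∀ m ∈ Subgroup.zpowers (x ^ q), m • v = v := by
      intro m hm
      have h1 : Subgroup.zpowers (x ^ q) ≤ MulAction.stabilizer G v := by
        rw [Subgroup.zpowers_le]
        exact Subgroup.pow_mem _ hxv q
      exact h1 hm
    have hconj : ∀ g : G, g • v = v → ∀ m ∈ Subgroup.zpowers (x ^ q),
        g * m * g⁻¹ ∈ Subgroup.zpowers (x ^ q) := by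
      rintro g hg _ ⟨k, rfl⟩
      show g * (x ^ q) ^ k * g⁻¹ ∈ _
      rw [← conj_zpow, ← conj_pow]
      rcases hx g hg with h2 | h2 <;> rw [h2]
      · exact Subgroup.zpow_mem _ (Subgroup.mem_zpowers _) k
      · rw [inv_pow]
        exact Subgroup.zpow_mem _ (Subgroup.inv_mem _ (Subgroup.mem_zpowers _)) k
    rcases h.trivial_or_transitive v (Subgroup.zpowers (x ^ q)) hM hconj with h1 | h1
    · exact absurd (h1 _ (Subgroup.mem_zpowers _) w hvw) hq
    · intro w' hw'
      obtain ⟨m, ⟨k, rfl⟩, hm⟩ := h1 w w' hvw hw'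
      exact ⟨k, hm⟩
  have hadj : ∀ k : ℤ, Γ.Adj v (x ^ k • w) := fun k => by
    have h1 : x ^ k • v = v := Subgroup.zpow_mem (MulAction.stabilizer G v) hxv k
    simpa [h1] using h.smul_adj (x ^ k) hvw
  have horb : MulAction.orbit (Subgroup.zpowers x) w = Γ.neighborSet v := by
    ext y
    constructor
    · rintro ⟨⟨_, k, rfl⟩, rfl⟩
      exact hadj k
    · intro hy
      obtain ⟨k, hk⟩ := htrans 1 (by rwa [pow_one]) y hy
      rw [pow_one] at hk
      exact ⟨⟨x ^ k, k, rfl⟩, hk⟩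
  let e := (MulAction.orbitZPowersEquiv x w).symm.trans (Equiv.setCongr horb)
  have hcard : Nat.card (Γ.neighborSet v) = Function.minimalPeriod (x • ·) w := by
    rw [← Nat.card_congr e, Nat.card_zmod]
  have he : ∀ k : ℤ, (e k : V) = x ^ k • w := fun k => by
    show (((MulAction.orbitZPowersEquiv x w).symm k : MulAction.orbit _ w) : V) = _
    rw [MulAction.orbitZPowersEquiv_symm_apply']
    rfl
  have hne0 : Nat.card (Γ.neighborSet v) ≠ 0 := by
    have : Nonempty (Γ.neighborSet v) := ⟨⟨w, hvw⟩⟩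
    exact Nat.card_pos.ne'
  clear_value e
  rw [hcard] at hne0 ⊢
  refine ⟨?_, e, he⟩
  set n := Function.minimalPeriod (x • ·) w with hn
  have hdvd : ∀ k : ℤ, x ^ k • w = w ↔ (n : ℤ) ∣ k := fun k =>
    MulAction.zpow_smul_eq_iff_minimalPeriod_dvd
  have hn1 : n ≠ 1 := fun hn1 => hxw (by
    have := (hdvd 1).2 (by rw [hn1]; simp)
    simpa using this)
  obtain ⟨q, hq, m, hm⟩ := Nat.exists_prime_and_dvd hn1
  by_cases hm1 : m = 1
  · rw [hm, hm1, mul_one]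
    exact hq
  exfalso
  -- If a prime q is a proper divisor of the cycle length n, then x^q still moves w, so some power
  -- x^(qk) agrees with x at w. Then n, and hence q, divides qk − 1, which is absurd.
  obtain ⟨k, hk⟩ := htrans q (fun hqw => by
    have h1 := (hdvd q).1 (by simpa using hqw)
    have h2 : n ∣ q := by exact_mod_cast h1
    rw [hm] at h2
    have h3 : m = 1 := by
      have := Nat.le_of_dvd hq.pos h2
      have hm0 : m ≠ 0 := by
        rintro rfl
        exact hne0 (by rw [hm, mul_zero])
      have hq0 := hq.pos
      have : m < 2 := by nlinarith
      omega
    exact hm1 h3) (x • w) (by simpa using hadj 1)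
  have h1 : x ^ ((q : ℤ) * k - 1) • w = w := by
    rw [sub_eq_neg_add, zpow_add, mul_smul, zpow_mul, zpow_natCast, hk, zpow_neg_one, inv_smul_smul]
  have h2 : (q : ℤ) ∣ (q : ℤ) * k - 1 := dvd_trans (by rw [hm]; simp) ((hdvd _).1 h1)
  have h3 : (q : ℤ) ∣ 1 := (dvd_sub_right (dvd_mul_right _ k)).1 h2
  exact hq.one_lt.ne' (by exact_mod_cast Int.eq_one_of_dvd_one (by positivity) h3)

end ActsLocallyQuasiprimitively

/-! ### Eigenvectors of 2 × 2 matrices -/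

section TwoByTwo

variable {K : Type*} [Field K]

/-- Determinant one and eigenvalue one force trace two, so the characteristic polynomial is (X − 1)²
and Cayley–Hamilton applies. -/
theorem Matrix.sub_one_sq_eq_zero {A : Matrix (Fin 2) (Fin 2) K} (hA : A.det = 1)
    (hA1 : (A - 1).det = 0) : (A - 1) ^ 2 = 0 := by
  rw [Matrix.det_fin_two] at hA hA1
  simp at hA1
  have ht : A 0 0 + A 1 1 = 2 := by linear_combination hA - hA1
  rw [pow_two]
  ext i j
  fin_cases i <;> fin_cases j <;> simp [Matrix.mul_apply, Fin.sum_univ_two]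
  · linear_combination (A 0 0) * ht - hA
  · linear_combination (A 0 1) * ht
  · linear_combination (A 1 0) * ht
  · linear_combination (A 1 1) * ht - hA

/-- A matrix commuting with a non-scalar `2 × 2` matrix preserves its eigenvectors. -/
theorem Matrix.exists_mulVec_eq_smul_of_commute {A B : Matrix (Fin 2) (Fin 2) K} {l : K}
    {e : Fin 2 → K} (he : e ≠ 0) (hAe : A.mulVec e = l • e) (hA : A ≠ l • 1) (hAB : A * B = B * A) :
    ∃ m : K, B.mulVec e = m • e := by
  set f := B.mulVec e with hf
  have hAf : A.mulVec f = l • f := by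
    rw [hf, Matrix.mulVec_mulVec, hAB, ← Matrix.mulVec_mulVec, hAe, Matrix.mulVec_smul]
  have e0 := congrFun hAe 0
  have e1 := congrFun hAe 1
  have f0 := congrFun hAf 0
  have f1 := congrFun hAf 1
  simp [Matrix.mulVec, dotProduct, Fin.sum_univ_two] at e0 e1 f0 f1
  have hdet : e 0 * f 1 - e 1 * f 0 = 0 := by
    by_contra hne
    refine hA ?_
    ext i j
    apply mul_right_cancel₀ hne
    fin_cases i <;> fin_cases j <;> simp [-mul_eq_mul_right_iff, -mul_eq_zero]
    · linear_combination f 1 * e0 - e 1 * f0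
    · linear_combination e 0 * f0 - f 0 * e0
    · linear_combination f 1 * e1 - e 1 * f1
    · linear_combination e 0 * f1 - f 0 * e1
  by_cases h0 : e 0 = 0
  · have h1 : e 1 ≠ 0 := fun h1 => he (by ext i; fin_cases i <;> simp [h0, h1])
    refine ⟨f 1 / e 1, ?_⟩
    ext i
    fin_cases i <;> simp
    · field_simp
      linear_combination -hdet
    · field_simp
  · refine ⟨f 0 / e 0, ?_⟩
    ext i
    fin_cases i <;> simp
    · field_simp
    · field_simp
      linear_combination hdet

theorem Matrix.exists_mulVec_eq_smul [IsAlgClosed K] (A : Matrix (Fin 2) (Fin 2) K) :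
    ∃ (l : K) (e : Fin 2 → K), e ≠ 0 ∧ A.mulVec e = l • e := by
  obtain ⟨l, hl⟩ := Module.End.exists_eigenvalue A.mulVecLin
  obtain ⟨e, he⟩ := hl.exists_hasEigenvector
  exact ⟨l, e, he.2, he.apply_eq_smul⟩

/-- An eigenvalue of a `2 × 2` matrix is a root of the characteristic polynomial. -/
theorem Matrix.eigenvalue_eq_zero {A : Matrix (Fin 2) (Fin 2) K} {l : K} {e : Fin 2 → K}
    (he : e ≠ 0) (hAe : A.mulVec e = l • e) : l ^ 2 - A.trace * l + A.det = 0 := by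
  have h1 : (A - l • 1).det = 0 := by
    refine Matrix.exists_mulVec_eq_zero_iff.1 ⟨e, he, ?_⟩
    rw [Matrix.sub_mulVec, hAe, Matrix.smul_mulVec, Matrix.one_mulVec, sub_self]
  rw [Matrix.det_fin_two] at h1
  simp at h1
  rw [Matrix.det_fin_two, Matrix.trace_fin_two]
  linear_combination h1

end TwoByTwo

/-! ### Two-dimensional linear groups of order prime to the characteristic -/

section LinearGroup

variable {S : Type*} [Group S] {K : Type*} [Field K] {p : ℕ} [Fact p.Prime] [CharP K p]
  {ψ : S →* Matrix (Fin 2) (Fin 2) K}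

/-- Such an element is unipotent, so its p-th power is 1 in characteristic p, while its order is
prime to p. Hence a determinant-one element is determined by its eigenvalue on a given eigenvector.
-/
theorem eq_one_of_mulVec_eq (hψ : Function.Injective ψ) (hp : (Nat.card S).Coprime p) {x : S}
    (hx : (ψ x).det = 1) {e : Fin 2 → K} (he : e ≠ 0) (hxe : (ψ x).mulVec e = e) : x = 1 := by
  have h1 : (ψ x - 1).det = 0 :=
    Matrix.exists_mulVec_eq_zero_iff.1 ⟨e, he, by rw [Matrix.sub_mulVec, hxe]; simp⟩
  have h2 : (ψ x - 1) ^ p = 0 :=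
    pow_eq_zero_of_le (Fact.out : p.Prime).two_le (Matrix.sub_one_sq_eq_zero hx h1)
  rw [sub_pow_char_of_commute p (Commute.one_right _), one_pow, sub_eq_zero, ← map_pow] at h2
  have h3 : x ^ p = 1 := hψ (by rw [h2, map_one])
  have h4 : orderOf x ∣ 1 := by
    rw [← (hp : Nat.gcd _ _ = 1)]
    exact Nat.dvd_gcd (orderOf_dvd_natCard x) (orderOf_dvd_of_pow_eq_one h3)
  exact orderOf_eq_one_iff.1 (Nat.dvd_one.1 h4)

/-- A scalar of determinant one has square 1, so x is not scalar. Its eigenspace for l is then a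
line, preserved by everything that commutes with x. -/
theorem exists_eigenvector_of_sq_ne_one [IsAlgClosed K] (hψ : Function.Injective ψ)
    (hp : (Nat.card S).Coprime p) {x : S} (hx : (ψ x).det = 1) (hx2 : x * x ≠ 1) :
    ∃ (l : K) (e : Fin 2 → K), e ≠ 0 ∧ (ψ x).mulVec e = l • e ∧
      ∀ y, Commute x y → ∃ m : K, (ψ y).mulVec e = m • e := by
  obtain ⟨l, e, he, hxe⟩ := (ψ x).exists_mulVec_eq_smul
  refine ⟨l, e, he, hxe, fun y hy => Matrix.exists_mulVec_eq_smul_of_commute he hxe (fun h1 => hx2 ?_)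
    (by rw [← map_mul, hy.eq, map_mul])⟩
  have h2 : l * l = 1 := by
    rw [← hx, h1, Matrix.det_fin_two]
    simp
  refine eq_one_of_mulVec_eq hψ hp (by rw [map_mul, Matrix.det_mul, hx, one_mul]) he ?_
  rw [map_mul, ← Matrix.mulVec_mulVec, hxe, Matrix.mulVec_smul, hxe, smul_smul, h2, one_smul]

/-- The eigenvalue on the common eigenvector is an injective character into the field, and finite
multiplicative groups in a field are cyclic. A homomorphism `j` is used because the application is
to a Sylow subgroup of a subgroup. -/
theorem isCyclic_of_commute [IsAlgClosed K] [Finite S] (hψ : Function.Injective ψ)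
    (hp : (Nat.card S).Coprime p) {x : S} (hx : (ψ x).det = 1) (hx2 : x * x ≠ 1) {T : Type*}
    [Group T] (j : T →* S) (hj : Function.Injective j) (hT : ∀ t, (ψ (j t)).det = 1)
    (hxT : ∀ t, Commute x (j t)) : IsCyclic T := by
  obtain ⟨l, e, he, -, hcomm⟩ := exists_eigenvector_of_sq_ne_one hψ hp hx hx2
  choose m hm using fun t => hcomm (j t) (hxT t)
  have hinj : ∀ a b : K, a • e = b • e → a = b := fun a b hab => smul_left_injective K he hab
  have : Finite T := Finite.of_injective j hj
  let χ : T →* K :=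
    { toFun := m
      map_one' := hinj _ _ (by rw [← hm, map_one, map_one, Matrix.one_mulVec, one_smul])
      map_mul' := fun a b => hinj _ _ (by
        rw [← hm, map_mul, map_mul, ← Matrix.mulVec_mulVec, hm, Matrix.mulVec_smul, hm, smul_smul,
          mul_comm]) }
  refine isCyclic_of_injective_ringHom (f := χ) ((injective_iff_map_eq_one χ).2 fun t ht => ?_)
  have h1 : m t = 1 := ht
  have h2 := eq_one_of_mulVec_eq hψ hp (hT t) he (by rw [hm, h1, one_smul])
  exact hj (by rw [h2, map_one])

theorem conj_eq_or_eq_inv [IsAlgClosed K] (hψ : Function.Injective ψ)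
    (hp : (Nat.card S).Coprime p) {x : S} (hx : (ψ x).det = 1) (hx2 : x * x ≠ 1) {g : S}
    (hg : Commute x (g * x * g⁻¹)) : g * x * g⁻¹ = x ∨ g * x * g⁻¹ = x⁻¹ := by
  obtain ⟨l, e, he, hxe, hcomm⟩ := exists_eigenvector_of_sq_ne_one hψ hp hx hx2
  obtain ⟨m, hm⟩ := hcomm _ hg
  have hgg : ψ g⁻¹ * ψ g = 1 := by rw [← map_mul, inv_mul_cancel, map_one]
  have hdet : (ψ (g * x * g⁻¹)).det = 1 := by
    rw [map_mul, map_mul, Matrix.det_mul_comm, ← mul_assoc, hgg, one_mul, hx]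
  have htr : (ψ (g * x * g⁻¹)).trace = (ψ x).trace := by
    rw [map_mul, map_mul, Matrix.trace_mul_comm, ← mul_assoc, hgg, one_mul]
  have h1 := Matrix.eigenvalue_eq_zero he hxe
  have h2 := Matrix.eigenvalue_eq_zero he hm
  rw [hdet, htr] at h2
  rw [hx] at h1
  -- Both l and m are roots of X² − (tr x)X + 1, whose roots are mutually inverse; the combination
  -- eliminates the trace.
  have h3 : (l - m) * (l * m - 1) = 0 := by linear_combination m * h1 - l * h2
  rcases mul_eq_zero.1 h3 with h3 | h3
  · left
    have hl : l ≠ 0 := by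
      rintro rfl
      simp at h1
    have h4 : x⁻¹ * (g * x * g⁻¹) = 1 := by
      refine eq_one_of_mulVec_eq hψ hp ?_ he ?_
      · rw [map_mul, Matrix.det_mul, hdet, mul_one]
        have := congrArg Matrix.det (show ψ x⁻¹ * ψ x = 1 by rw [← map_mul, inv_mul_cancel, map_one])
        rwa [Matrix.det_mul, hx, mul_one, Matrix.det_one] at this
      · rw [map_mul, ← Matrix.mulVec_mulVec, hm, ← sub_eq_zero.1 h3, ← hxe, Matrix.mulVec_mulVec,
          ← map_mul, inv_mul_cancel, map_one, Matrix.one_mulVec]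
    exact (inv_mul_eq_one.1 h4).symm
  · right
    have h4 : x * (g * x * g⁻¹) = 1 := by
      refine eq_one_of_mulVec_eq hψ hp (by rw [map_mul, Matrix.det_mul, hx, hdet, one_mul]) he ?_
      rw [map_mul, ← Matrix.mulVec_mulVec, hm, Matrix.mulVec_smul, hxe, smul_smul, mul_comm,
        sub_eq_zero.1 h3, one_smul]
    exact (inv_eq_of_mul_eq_one_right h4).symm

theorem conj_eq_of_mul_self (hψ : Function.Injective ψ) {x : S} (hx : (ψ x).det = 1)
    (hp2 : p ≠ 2) (hx2 : x * x = 1) (g : S) : g * x * g⁻¹ = x := by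
  have h2 : (2 : K) ≠ 0 := by
    intro h2
    have : p ∣ 2 := (CharP.cast_eq_zero_iff K p 2).1 (by exact_mod_cast h2)
    exact hp2 ((Nat.prime_dvd_prime_iff_eq Fact.out Nat.prime_two).1 this)
  -- Cayley–Hamilton together with x² = 1 gives (tr x)·x = 2. As 2 ≠ 0, the trace is invertible and
  -- x is scalar, hence central.
  obtain ⟨a, ha⟩ : ∃ a : K, ψ x = a • 1 := by
    have h3 : ψ x * ψ x = 1 := by rw [← map_mul, hx2, map_one]
    rw [Matrix.det_fin_two] at hx
    have e00 := congrFun (congrFun h3 0) 0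
    have e01 := congrFun (congrFun h3 0) 1
    have e10 := congrFun (congrFun h3 1) 0
    have e11 := congrFun (congrFun h3 1) 1
    simp [Matrix.mul_apply, Fin.sum_univ_two] at e00 e01 e10 e11
    have ht : ψ x 0 0 * (ψ x 0 0 + ψ x 1 1) = 2 := by linear_combination e00 + hx
    have ht0 : ψ x 0 0 + ψ x 1 1 ≠ 0 := fun h0 => h2 (by rw [← ht, h0, mul_zero])
    refine ⟨ψ x 0 0, ?_⟩
    ext i j
    apply mul_right_cancel₀ ht0
    fin_cases i <;> fin_cases j <;> simp [-mul_eq_mul_right_iff, -mul_eq_zero]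
    · linear_combination e01
    · linear_combination e10
    · linear_combination e11 - e00
  have h3 : g * x = x * g := hψ (by rw [map_mul, map_mul, ha]; simp)
  rw [h3, mul_inv_cancel_right]

/-- Let `S` be a group of invertible `2 × 2` matrices, of order coprime to the characteristic,
such that the elements of determinant one form a minimal normal subgroup. Then this subgroup
contains a non-trivial element conjugate only to itself and its inverse. -/
theorem exists_conj_eq_or_eq_inv [IsAlgClosed K] [Finite S] (hψ : Function.Injective ψ)
    (hp : (Nat.card S).Coprime p) (hp2 : p ≠ 2) {N : Subgroup S} [N.Normal]
    (hN : ∀ x ∈ N, (ψ x).det = 1) (hne : N ≠ ⊥)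
    (hmin : ∀ M : Subgroup S, M.Normal → M ≤ N → M ≠ ⊥ → M = N) :
    ∃ x ∈ N, x ≠ 1 ∧ ∀ g, g * x * g⁻¹ = x ∨ g * x * g⁻¹ = x⁻¹ := by
  by_cases hinv : ∃ x ∈ N, x ≠ 1 ∧ x * x = 1
  · obtain ⟨x, hx, hx1, hx2⟩ := hinv
    exact ⟨x, hx, hx1, fun g => Or.inl (conj_eq_of_mul_self hψ (hN x hx) hp2 hx2 g)⟩
  push Not at hinv
  -- A non-trivial central element of a Sylow subgroup has square ≠ 1, so that subgroup, commuting
  -- with it, is cyclic.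
  have hZ : IsZGroup N := ⟨fun q hq Q => by
    have : Fact q.Prime := ⟨hq⟩
    by_cases hQ : Nontrivial Q
    · have := Q.2.center_nontrivial
      obtain ⟨z, hz⟩ := exists_ne (1 : Subgroup.center Q)
      have hz1 : ((z : Q) : S) ≠ 1 := by simpa using hz
      refine isCyclic_of_commute hψ hp (hN _ z.1.1.2) (hinv _ z.1.1.2 hz1)
        (N.subtype.comp (Q : Subgroup N).subtype)
        (N.subtype_injective.comp (Q : Subgroup N).subtype_injective) (fun t => hN _ t.1.2)
        (fun t => ?_)
      have := Subgroup.mem_center_iff.1 z.2 t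
      exact (congrArg (fun u : Q => ((u : N) : S)) this).symm
    · have : Subsingleton Q := not_nontrivial_iff_subsingleton.1 hQ
      exact isCyclic_of_subsingleton⟩
  -- A finite group with cyclic Sylow subgroups is soluble, so the derived subgroup of N is proper;
  -- by minimality it is trivial.
  have hcomm : ⁅N, N⁆ = ⊥ := by
    by_contra hC
    have h1 := hmin ⁅N, N⁆ inferInstance (Subgroup.commutator_le_left N N) hC
    have : Nontrivial N := (Subgroup.nontrivial_iff_ne_bot N).2 hne
    have h2 := Group.IsSolvable.commutator_lt_top_of_nontrivial N
    rw [← Subgroup.map_subtype_commutator] at h1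
    refine h2.ne (Subgroup.map_injective N.subtype_injective ?_)
    rw [h1, ← MonoidHom.range_eq_map, Subgroup.range_subtype]
  rw [Subgroup.commutator_eq_bot_iff_le_centralizer] at hcomm
  obtain ⟨⟨x, hx⟩, hx1⟩ := Subgroup.ne_bot_iff_exists_ne_one.1 hne
  have hx1' : x ≠ 1 := fun h => hx1 (Subtype.ext h)
  refine ⟨x, hx, hx1', fun g => conj_eq_or_eq_inv hψ hp (hN x hx) (hinv x hx hx1') ?_⟩
  exact (hcomm (Subgroup.Normal.conj_mem inferInstance x hx g) x hx)

end LinearGroup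

/-! ### Elementary abelian P of rank two -/

/-- The automorphism group of an elementary abelian group of rank two, as a matrix group. -/
theorem exists_matrix_representation {p : ℕ} {A : Type*} [Group A]
    (f : A ≃* Multiplicative (Fin 2 → ZMod p)) :
    ∃ ψ : MulAut A →* Matrix (Fin 2) (Fin 2) (ZMod p), Function.Injective ψ ∧
      ∀ s x, (f (s x)).toAdd = (ψ s).mulVec (f x).toAdd := by
  have hex : ∀ s : MulAut A, ∃ M : Matrix (Fin 2) (Fin 2) (ZMod p),
      ∀ x, (f (s x)).toAdd = M.mulVec (f x).toAdd := by
    intro s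
    let a : (Fin 2 → ZMod p) →+ (Fin 2 → ZMod p) :=
      MonoidHom.toAdditive ((f.symm.trans s).trans f).toMonoidHom
    have ha : ∀ y, a y = (f (s (f.symm (Multiplicative.ofAdd y)))).toAdd := fun _ => rfl
    refine ⟨LinearMap.toMatrix' (a.toZModLinearMap p), fun x => ?_⟩
    rw [LinearMap.toMatrix'_mulVec, AddMonoidHom.coe_toZModLinearMap, ha, ofAdd_toAdd,
      f.symm_apply_apply]
  choose M hM using hex
  have huniq : ∀ B C : Matrix (Fin 2) (Fin 2) (ZMod p),
      (∀ x, B.mulVec (f x).toAdd = C.mulVec (f x).toAdd) → B = C := by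
    intro B C hBC
    refine Matrix.ext_of_mulVec_single fun i => ?_
    simpa using hBC (f.symm (Multiplicative.ofAdd (Pi.single i 1)))
  refine ⟨{ toFun := M, map_one' := ?_, map_mul' := ?_ }, ?_, hM⟩
  · exact huniq _ _ fun x => by rw [← hM, MulAut.one_apply, Matrix.one_mulVec]
  · exact fun s t => huniq _ _ fun x => by
      rw [← hM, MulAut.mul_apply, hM, hM, Matrix.mulVec_mulVec]
  · intro s t hst
    have hst' : M s = M t := hst
    refine MulEquiv.ext fun x => f.injective (Multiplicative.toAdd.injective ?_)
    rw [hM, hM, hst']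

namespace ActsLocallyQuasiprimitively

variable {G : Type*} [Group G] [Finite G] {V : Type*} [MulAction G V] {Γ : SimpleGraph V}
  {P : Subgroup G} [P.Normal] [IsMulCommutative P]

/-- If `P` is elementary abelian of rank two then a vertex stabiliser has an element that is
conjugate only to itself and its inverse and is non-trivial on the neighbourhood. -/
theorem exists_conj_eq_or_eq_inv_of_rank_two [FaithfulSMul G V]
    (h : ActsLocallyQuasiprimitively G Γ) (hP : (Nat.card P).Coprime P.index)
    (hodd : Odd (Nat.card P)) (hne : P ≠ ⊥) (hsemi : ∀ x ∈ P, ∀ v : V, x • v = v → x = 1)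
    {p : ℕ} [Fact p.Prime] (hp2 : p ≠ 2) {v w w' : V}
    (hp : (Nat.card (MulAction.stabilizer G v)).Coprime p)
    (f : P ≃* Multiplicative (Fin 2 → ZMod p)) (hvw : Γ.Adj v w) (hvw' : Γ.Adj v w')
    (hww' : w ≠ w') :
    ∃ x : G, x • v = v ∧ x • w ≠ w ∧
      ∀ g : G, g • v = v → g * x * g⁻¹ = x ∨ g * x * g⁻¹ = x⁻¹ := by
  let K := AlgebraicClosure (ZMod p)
  have : CharP K p := charP_of_injective_algebraMap (algebraMap (ZMod p) K).injective p
  let S := MulAction.stabilizer G v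
  obtain ⟨ψ₀, hψ₀, hψ₀f⟩ := exists_matrix_representation f
  let ψ : S →* Matrix (Fin 2) (Fin 2) K :=
    ((algebraMap (ZMod p) K).mapMatrix.toMonoidHom.comp ψ₀).comp
      ((MulAut.conjNormal (H := P)).comp S.subtype)
  have hψ_apply : ∀ s : S, ψ s = (ψ₀ (MulAut.conjNormal (s : G))).map (algebraMap (ZMod p) K) :=
    fun _ => rfl
  have hψ : Function.Injective ψ := by
    rw [injective_iff_map_eq_one]
    intro s hs
    have h1 : ψ s = (ψ₀ 1).map (algebraMap (ZMod p) K) := by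
      rw [hs, map_one, Matrix.map_one _ (map_zero _) (map_one _)]
    rw [hψ_apply] at h1
    have h2 := hψ₀ (Matrix.map_injective (algebraMap (ZMod p) K).injective h1)
    exact Subtype.ext (h.eq_one_of_centralizes hP hodd hne hsemi s.2 h2)
  obtain ⟨y, hy1, hy⟩ := h.exists_commute_of_fixes_arc hP hodd hne hsemi hvw
  -- The determinant-one elements are semiregular on Γ(v): one that fixes w centralises y, a
  -- non-zero fixed vector.
  have hfix : ∀ s : S, (ψ s).det = 1 → (s : G) • w = w → s = 1 := by
    intro s hs hsw
    have h1 := hψ₀f (MulAut.conjNormal (s : G)) y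
    rw [hy s s.2 hsw] at h1
    refine eq_one_of_mulVec_eq hψ hp hs (e := fun i => algebraMap (ZMod p) K ((f y).toAdd i)) ?_ ?_
    · intro h0
      refine hy1 ((map_eq_one_iff f f.injective).1 (Multiplicative.toAdd.injective ?_))
      funext i
      exact (algebraMap (ZMod p) K).injective ((congrFun h0 i).trans (map_zero _).symm)
    · funext i
      rw [hψ_apply]
      conv_rhs => rw [h1]
      exact (RingHom.map_mulVec (algebraMap (ZMod p) K) _ _ i).symm
  let N : Subgroup S := (Matrix.detMonoidHom.comp ψ).ker
  have hN : ∀ s, s ∈ N ↔ (ψ s).det = 1 := fun s => Iff.rfl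
  by_cases hNbot : N = ⊥
  -- The determinant is injective on G_v, so G_v is abelian and any element moving w works.
  · obtain ⟨x, hxv, hxw⟩ := h.exists_stabilizer_smul_eq hvw hvw'
    refine ⟨x, hxv, by rw [hxw]; exact hww'.symm, fun g hg => Or.inl ?_⟩
    have h1 : (⟨g, hg⟩ * ⟨x, hxv⟩ * ⟨g, hg⟩⁻¹ * ⟨x, hxv⟩⁻¹ : S) ∈ N := by
      show Matrix.detMonoidHom.comp ψ _ = 1
      generalize (⟨g, hg⟩ : S) = a
      generalize (⟨x, hxv⟩ : S) = b
      have ha := congrArg (Matrix.detMonoidHom.comp ψ) (mul_inv_cancel a)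
      have hb := congrArg (Matrix.detMonoidHom.comp ψ) (mul_inv_cancel b)
      rw [map_mul, map_one] at ha hb
      rw [map_mul, map_mul, map_mul, mul_right_comm, mul_assoc (Matrix.detMonoidHom.comp ψ a),
        hb, mul_one, ha]
    rw [hNbot, Subgroup.mem_bot, mul_inv_eq_one, mul_inv_eq_iff_eq_mul] at h1
    have h2 : g * x = x * g := congrArg Subtype.val h1
    rw [h2, mul_inv_cancel_right]
  -- A non-trivial normal M ≤ N moves w, so it is transitive on Γ(v) by local quasiprimitivity; as N
  -- is semiregular there, M = N.
  · have hmin : ∀ M : Subgroup S, M.Normal → M ≤ N → M ≠ ⊥ → M = N := by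
      intro M hM hMN hMne
      have hconj : ∀ g : G, g • v = v → ∀ m ∈ M.map S.subtype, g * m * g⁻¹ ∈ M.map S.subtype := by
        rintro g hg _ ⟨m, hm, rfl⟩
        exact ⟨_, hM.conj_mem m hm ⟨g, hg⟩, rfl⟩
      have hMv : ∀ m ∈ M.map S.subtype, m • v = v := by
        rintro _ ⟨m, -, rfl⟩
        exact m.2
      rcases h.trivial_or_transitive v _ hMv hconj with h1 | h1
      · refine absurd ?_ hMne
        rw [eq_bot_iff]
        exact fun m hm => hfix m (hMN hm) (h1 _ ⟨m, hm, rfl⟩ w hvw)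
      · refine le_antisymm hMN fun n hn => ?_
        have hnw : Γ.Adj v ((n : G) • w) := by
          have h2 := h.smul_adj (n : G) hvw
          rwa [show (n : G) • v = v from n.2] at h2
        obtain ⟨_, ⟨m, hm, rfl⟩, hmw⟩ := h1 w _ hvw hnw
        have h2 : m⁻¹ * n = 1 := hfix _ ((hN _).1 (N.mul_mem (N.inv_mem (hMN hm)) hn)) (by
          rw [Subgroup.coe_mul, mul_smul, ← hmw]
          exact inv_smul_smul (m : G) w)
        rwa [← inv_mul_eq_one.1 h2]
    obtain ⟨x, hxN, hx1, hx⟩ :=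
      exists_conj_eq_or_eq_inv hψ hp hp2 (fun s hs => (hN s).1 hs) hNbot hmin
    refine ⟨x, x.2, fun hxw => hx1 (hfix x hxN hxw), fun g hg => ?_⟩
    exact (hx ⟨g, hg⟩).imp (congrArg Subtype.val) (congrArg Subtype.val)

end ActsLocallyQuasiprimitively

/-! ### Abelian vertex stabilisers and cyclic P -/

namespace ActsLocallyQuasiprimitively

variable {G : Type*} [Group G] {V : Type*} [MulAction G V] {Γ : SimpleGraph V}

/-- If the vertex stabilisers are commutative then the arc stabilisers are trivial. -/
theorem eq_one_of_fixes_arc [FaithfulSMul G V] (h : ActsLocallyQuasiprimitively G Γ)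
    (hcomm : ∀ (v : V) (a b : G), a • v = v → b • v = v → a * b = b * a) {v w : V}
    (hvw : Γ.Adj v w) {g : G} (hgv : g • v = v) (hgw : g • w = w) : g = 1 := by
  have key : ∀ u y, Γ.Adj u y → g • u = u → g • y = y → ∀ z, Γ.Adj u z → g • z = z := by
    intro u y huy hu hy z hz
    obtain ⟨a, hau, haz⟩ := h.exists_stabilizer_smul_eq huy hz
    rw [← haz, ← mul_smul, hcomm u g a hu hau, mul_smul, hy]
  refine FaithfulSMul.eq_of_smul_eq_smul (α := V) fun u => ?_
  rw [one_smul]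
  refine (h.mem_of_closed (S := fun u => g • u = u ∧ ∀ z, Γ.Adj u z → g • z = z)
    ⟨hgv, key v w hvw hgv hgw⟩ ?_ u).1
  rintro a b ⟨ha, hab⟩ hadj
  exact ⟨hab b hadj, key b a hadj.symm (hab b hadj) ha⟩

theorem card_stabilizer_of_regular (h : ActsLocallyQuasiprimitively G Γ) {v w : V}
    (hvw : Γ.Adj v w) (hreg : ∀ g : G, g • v = v → g • w = w → g = 1) :
    Nat.card (MulAction.stabilizer G v) = Nat.card (Γ.neighborSet v) := by
  refine Nat.card_congr (Equiv.ofBijective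
    (fun g : MulAction.stabilizer G v => (⟨(g : G) • w, by
      have h1 := h.smul_adj (g : G) hvw
      rwa [show (g : G) • v = v from g.2] at h1⟩ : Γ.neighborSet v)) ⟨fun a b hab => ?_, ?_⟩)
  · have h1 : (a : G) • w = (b : G) • w := congrArg Subtype.val hab
    have h2 := hreg ((b : G)⁻¹ * a)
      ((b⁻¹ * a : MulAction.stabilizer G v).2) (by rw [mul_smul, h1, inv_smul_smul])
    exact Subtype.ext (inv_mul_eq_one.1 h2).symm
  · rintro ⟨y, hy⟩
    obtain ⟨g, hg, hgy⟩ := h.exists_stabilizer_smul_eq hvw hy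
    exact ⟨⟨g, hg⟩, Subtype.ext hgy⟩

variable [Finite G] {P : Subgroup G} [P.Normal] [IsMulCommutative P]

/-- If `P` is cyclic then the vertex stabilisers are commutative. -/
theorem commute_of_isCyclic [FaithfulSMul G V] [IsCyclic P] (h : ActsLocallyQuasiprimitively G Γ)
    (hP : (Nat.card P).Coprime P.index) (hodd : Odd (Nat.card P)) (hne : P ≠ ⊥)
    (hsemi : ∀ x ∈ P, ∀ v : V, x • v = v → x = 1) (v : V) (a b : G) (ha : a • v = v)
    (hb : b • v = v) : a * b = b * a := by
  have h1 := h.eq_one_of_centralizes hP hodd hne hsemi (v := v) (g := a * b * a⁻¹ * b⁻¹)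
    (by rw [mul_smul, mul_smul, mul_smul, inv_smul_eq_iff.2 hb.symm, inv_smul_eq_iff.2 ha.symm, hb,
      ha]) (by
    apply (IsCyclic.mulAutMulEquiv P).injective
    simp only [map_mul, map_inv, map_one]
    rw [mul_inv_eq_one, mul_inv_eq_iff_eq_mul, mul_comm])
  rwa [mul_inv_eq_one, mul_inv_eq_iff_eq_mul] at h1

/-- If `P` is cyclic and the valency is an odd prime `d` then the abelianisation of `G/P` is
cyclic of order `2d`. -/
theorem abelianization_quotient_of_isCyclic [FaithfulSMul G V] [IsCyclic P]
    (h : ActsLocallyQuasiprimitively G Γ) (hP : (Nat.card P).Coprime P.index)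
    (hodd : Odd (Nat.card P)) (hne : P ≠ ⊥) (hsemi : ∀ x ∈ P, ∀ v : V, x • v = v → x = 1)
    {d : ℕ} (hd : d.Prime) (hd2 : Odd d) {v : V} (hdv : Nat.card (Γ.neighborSet v) = d) :
    Nat.card (MulAction.stabilizer G v) = d ∧ 2 * d ∣ (Nat.card P).totient ∧
      Nonempty (Abelianization (G ⧸ P) ≃* Multiplicative (ZMod (2 * d))) := by
  obtain ⟨w, hvw⟩ := h.exists_adj v
  obtain ⟨t, htv, htw⟩ := h.exists_swap hvw
  have hreg : ∀ g : G, g • v = v → g • w = w → g = 1 := fun g hgv hgw =>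
    h.eq_one_of_fixes_arc (h.commute_of_isCyclic hP hodd hne hsemi) hvw hgv hgw
  have hcard := (h.card_stabilizer_of_regular hvw hreg).trans hdv
  have : Fact d.Prime := ⟨hd⟩
  have hnt : Nontrivial (MulAction.stabilizer G v) := by
    rw [← Finite.one_lt_card_iff_nontrivial, hcard]
    exact hd.one_lt
  obtain ⟨⟨x, hxv⟩, hx1⟩ := exists_ne (1 : MulAction.stabilizer G v)
  have hxd : x ^ d = 1 := by
    have h1 := pow_card_eq_one' (x := (⟨x, hxv⟩ : MulAction.stabilizer G v))
    rw [hcard] at h1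
    exact congrArg Subtype.val h1
  have hxgen : ∀ g : G, g • v = v → g ∈ Subgroup.zpowers x := by
    intro g hg
    obtain ⟨k, hk⟩ := mem_zpowers_of_prime_card hcard hx1
      (g' := (⟨g, hg⟩ : MulAction.stabilizer G v))
    exact ⟨k, congrArg Subtype.val hk⟩
  have ht2 : t ^ 2 = 1 := hreg _ (by rw [pow_two, mul_smul, htv, htw])
    (by rw [pow_two, mul_smul, htw, htv])
  let ρ : G →* (ZMod (Nat.card P))ˣ :=
    (IsCyclic.mulAutMulEquiv P).toMonoidHom.comp MulAut.conjNormal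
  have hρ : ∀ g, ρ g = 1 → MulAut.conjNormal (H := P) g = 1 := fun g hg =>
    (map_eq_one_iff _ (IsCyclic.mulAutMulEquiv P).injective).1 hg
  have hρP : P ≤ ρ.ker := fun y hy => by
    have h1 : MulAut.conjNormal (H := P) y = 1 := MulEquiv.ext fun z => Subtype.ext (by
      have h2 : y * (z : G) = z * y := congrArg Subtype.val (mul_comm' (⟨y, hy⟩ : P) z)
      rw [MulAut.conjNormal_apply, h2, mul_inv_cancel_right, MulAut.one_apply])
    show (IsCyclic.mulAutMulEquiv P) (MulAut.conjNormal y) = 1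
    rw [h1, map_one]
  have hox : orderOf (ρ x) = d := orderOf_eq_prime (by rw [← map_pow, hxd, map_one]) fun h1 =>
    hx1 (Subtype.ext (h.eq_one_of_centralizes hP hodd hne hsemi hxv (hρ x h1)))
  have hot : orderOf (ρ t) = 2 := orderOf_eq_prime (by rw [← map_pow, ht2, map_one]) fun h1 =>
    h.not_centralizes_of_swap hP hodd hne hsemi hvw htv htw (hρ t h1)
  have hoxt : orderOf (ρ (x * t)) = 2 * d := by
    rw [map_mul, (Commute.all _ _).orderOf_mul_eq_mul_orderOf_of_coprime, hox, hot, mul_comm]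
    rw [hox, hot]
    exact Nat.coprime_two_right.2 hd2
  refine ⟨hcard, ?_, ?_⟩
  · rw [← hoxt, ← ZMod.card_units_eq_totient, ← Nat.card_eq_fintype_card]
    exact orderOf_dvd_natCard _
  let π : G →* Abelianization (G ⧸ P) := Abelianization.of.comp (QuotientGroup.mk' P)
  have hπ : Function.Surjective π :=
    (QuotientGroup.mk_surjective (s := commutator (G ⧸ P))).comp (QuotientGroup.mk'_surjective P)
  let θ : Abelianization (G ⧸ P) →* (ZMod (Nat.card P))ˣ :=
    Abelianization.lift (QuotientGroup.lift P ρ hρP)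
  have hθ : ∀ g, θ (π g) = ρ g := fun _ => rfl
  -- With x^d = 1, t² = 1 and d odd, the d-th power of the image of xt is the image of t. So xt
  -- generates the abelianisation.
  have hπt : π t ∈ Subgroup.zpowers (π (x * t)) := by
    obtain ⟨m, hm⟩ := hd2
    refine ⟨d, ?_⟩
    show π (x * t) ^ (d : ℤ) = π t
    rw [zpow_natCast, map_mul, mul_pow, ← map_pow, hxd, map_one, one_mul, hm, pow_succ, pow_mul,
      ← map_pow, ht2, map_one, one_pow, one_mul]
  have hπx : π x ∈ Subgroup.zpowers (π (x * t)) := by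
    have h1 := Subgroup.mul_mem _ (Subgroup.mem_zpowers (π (x * t))) (Subgroup.inv_mem _ hπt)
    rwa [map_mul, mul_inv_cancel_right] at h1
  have htop := h.eq_top_of_stabilizer_le (H := (Subgroup.zpowers (π (x * t))).comap π) hvw htv
    (fun g hg => by
      obtain ⟨k, rfl⟩ := hxgen g hg
      show π (x ^ k) ∈ Subgroup.zpowers (π (x * t))
      rw [map_zpow]
      exact Subgroup.zpow_mem _ hπx k) hπt
  have hgen : ∀ a : Abelianization (G ⧸ P), a ∈ Subgroup.zpowers (π (x * t)) := fun a => by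
    obtain ⟨g, rfl⟩ := hπ a
    have : g ∈ (Subgroup.zpowers (π (x * t))).comap π := htop ▸ Subgroup.mem_top g
    exact this
  have : IsCyclic (Abelianization (G ⧸ P)) := ⟨_, hgen⟩
  refine ⟨mulEquivOfCyclicCardEq ?_⟩
  rw [← orderOf_eq_card_of_forall_mem_zpowers hgen, Nat.card_congr Multiplicative.toAdd,
    Nat.card_zmod]
  refine Nat.dvd_antisymm (orderOf_dvd_of_pow_eq_one ?_) ?_
  · rw [map_mul, mul_pow, ← map_pow, ← map_pow, mul_comm 2 d, pow_mul, hxd, mul_comm d 2, pow_mul,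
      ht2, one_pow, one_pow, map_one, one_mul]
  -- The action on the cyclic group P factors through the abelianisation of G/P, and there xt
  -- already has order 2d; this bounds the order from below.
  · rw [← hoxt, ← hθ]
    exact orderOf_map_dvd θ _

end ActsLocallyQuasiprimitively

theorem IsPermIso.symm {α β : Type*} {H : Subgroup (Equiv.Perm α)} {L : Subgroup (Equiv.Perm β)}
    (h : IsPermIso H L) : IsPermIso L H := by
  obtain ⟨e, he⟩ := h
  refine ⟨e.symm, fun σ => ?_⟩
  rw [he, show e.permCongr (e.symm.permCongr σ) = σ from e.permCongr.apply_symm_apply σ]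

theorem IsPermIso.trans {α β γ : Type*} {H : Subgroup (Equiv.Perm α)}
    {L : Subgroup (Equiv.Perm β)} {M : Subgroup (Equiv.Perm γ)} (h : IsPermIso H L)
    (h' : IsPermIso L M) : IsPermIso H M := by
  obtain ⟨e, he⟩ := h
  obtain ⟨f, hf⟩ := h'
  exact ⟨e.trans f, fun σ => (he σ).trans (hf _)⟩

/-! ### From the permutation group on a neighbourhood to the abstract action -/

section LocalAction

variable {V : Type*} {Γ : SimpleGraph V} {G : Subgroup (Γ ≃g Γ)}

theorem exists_mem_localAction {v : V} {g : G} (hg : g • v = v) :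
    ∃ σ ∈ localAction G v, ∀ x, ((σ x : Γ.neighborSet v) : V) = g • (x : V) := by
  have hg' : g.1 v = v := hg
  have hginv : g⁻¹ • v = v := inv_smul_eq_iff.2 hg.symm
  have hadj : ∀ (a : G), a • v = v → ∀ x : Γ.neighborSet v, Γ.Adj v (a • (x : V)) := by
    intro a ha x
    have h1 : Γ.Adj (a • v) (a • (x : V)) := a.1.map_adj_iff.2 x.2
    rwa [ha] at h1
  exact ⟨⟨fun x => ⟨g • (x : V), hadj g hg x⟩, fun x => ⟨g⁻¹ • (x : V), hadj _ hginv x⟩,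
    fun x => Subtype.ext (inv_smul_smul g _), fun x => Subtype.ext (smul_inv_smul g _)⟩,
    ⟨g, g.2, hg', fun x => rfl⟩, fun x => rfl⟩

theorem exists_of_mem_localAction {v : V} {σ : Equiv.Perm (Γ.neighborSet v)}
    (hσ : σ ∈ localAction G v) :
    ∃ g : G, g • v = v ∧ ∀ x, ((σ x : Γ.neighborSet v) : V) = g • (x : V) := by
  obtain ⟨g, hg, hgv, hx⟩ := hσ
  exact ⟨⟨g, hg⟩, hgv, hx⟩

theorem actsLocallyQuasiprimitively_of_isLocally (hΓ : Γ.Connected) (hG : IsArcTransitive G)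
    {Ω : Type*} {L : Subgroup (Equiv.Perm Ω)} [Nonempty Ω]
    (hL : MulAction.IsQuasiPreprimitive L Ω) (hGL : IsLocally G L) :
    ActsLocallyQuasiprimitively G Γ where
  connected := hΓ
  smul_adj g _ _ huv := g.1.map_adj_iff.2 huv
  exists_adj v := by
    obtain ⟨e, -⟩ := hGL v
    exact ⟨e.symm (Classical.arbitrary Ω), (e.symm (Classical.arbitrary Ω)).2⟩
  arc_transitive u v u' v' h h' := by
    obtain ⟨g, hg, h1, h2⟩ := hG u v u' v' h h'
    exact ⟨⟨g, hg⟩, h1, h2⟩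
  trivial_or_transitive v M hMv hMconj := by
    obtain ⟨e, he⟩ := hGL v
    have hlift : ∀ g : G, g • v = v → ∃ τ : L, ∀ x : Γ.neighborSet v,
        ((e.symm (τ • e x) : Γ.neighborSet v) : V) = g • (x : V) := by
      intro g hg
      obtain ⟨σ, hσ, hσx⟩ := exists_mem_localAction hg
      refine ⟨⟨_, (he σ).1 hσ⟩, fun x => ?_⟩
      rw [← hσx]
      simp [Subgroup.smul_def]
    have hdesc : ∀ τ : L, ∃ g : G, g • v = v ∧ ∀ x : Γ.neighborSet v,
        ((e.symm (τ • e x) : Γ.neighborSet v) : V) = g • (x : V) := by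
      intro τ
      obtain ⟨g, hg, hgx⟩ := exists_of_mem_localAction
        ((he (e.symm.permCongr (τ : Equiv.Perm Ω))).2 (by
          rw [show e.permCongr (e.symm.permCongr (τ : Equiv.Perm Ω)) = τ from
            e.permCongr.apply_symm_apply _]
          exact τ.2))
      refine ⟨g, hg, fun x => ?_⟩
      rw [← hgx]
      simp [Subgroup.smul_def]
    -- The image of M in L. It is normal because every element of L is induced by an element of G_v,
    -- so quasiprimitivity applies to it.
    let M' : Subgroup L :=
      { carrier := {τ | ∃ m ∈ M, ∀ x : Γ.neighborSet v,
          ((e.symm (τ • e x) : Γ.neighborSet v) : V) = m • (x : V)}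
        one_mem' := ⟨1, M.one_mem, fun x => by simp⟩
        mul_mem' := by
          rintro a b ⟨m, hm, hmx⟩ ⟨n, hn, hnx⟩
          refine ⟨m * n, M.mul_mem hm hn, fun x => ?_⟩
          rw [mul_smul, mul_smul, ← hnx, ← hmx, e.apply_symm_apply]
        inv_mem' := by
          rintro a ⟨m, hm, hmx⟩
          refine ⟨m⁻¹, M.inv_mem hm, fun x => ?_⟩
          rw [eq_inv_smul_iff, ← hmx, e.apply_symm_apply, smul_inv_smul, e.symm_apply_apply] }
    have hM' : M'.Normal := ⟨by
      rintro a ⟨m, hm, hmx⟩ b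
      obtain ⟨g, hg, hgx⟩ := hdesc b
      refine ⟨g * m * g⁻¹, hMconj g hg m hm, fun x => ?_⟩
      have h1 : ∀ y : Γ.neighborSet v,
          ((e.symm (b⁻¹ • e y) : Γ.neighborSet v) : V) = g⁻¹ • (y : V) := fun y => by
        rw [eq_inv_smul_iff, ← hgx, e.apply_symm_apply, smul_inv_smul, e.symm_apply_apply]
      rw [mul_smul, mul_smul, mul_smul, mul_smul, ← h1, ← hmx, ← hgx, e.apply_symm_apply,
        e.apply_symm_apply]⟩
    by_cases hfix : MulAction.fixedPoints M' Ω = Set.univ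
    · left
      intro m hm w hw
      obtain ⟨τ, hτ⟩ := hlift m (hMv m hm)
      have h1 : e ⟨w, hw⟩ ∈ MulAction.fixedPoints M' Ω := hfix ▸ Set.mem_univ _
      have h2 : τ • e ⟨w, hw⟩ = e ⟨w, hw⟩ := h1 ⟨τ, m, hm, hτ⟩
      have h3 := hτ ⟨w, hw⟩
      rw [h2, e.symm_apply_apply] at h3
      exact h3.symm
    · right
      intro w w' hw hw'
      obtain ⟨⟨τ, m, hm, hmx⟩, hτ⟩ :=
        (hL.isPretransitive_of_normal hfix).exists_smul_eq (e ⟨w, hw⟩) (e ⟨w', hw'⟩)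
      refine ⟨m, hm, ?_⟩
      have h2 : τ • e ⟨w, hw⟩ = e ⟨w', hw'⟩ := hτ
      have h3 := hmx ⟨w, hw⟩
      rw [h2, e.symm_apply_apply] at h3
      exact h3.symm

/-- If an element of the vertex stabiliser permutes the neighbourhood in one cycle and is
conjugate only to itself and its inverse, then the local action is cyclic or dihedral. -/
theorem isPermIso_localAction_cyclic_or_dihedral {v w : V} {n : ℕ} {x : G} (hxv : x • v = v)
    (e : ZMod n ≃ Γ.neighborSet v) (he : ∀ k : ℤ, (e k : V) = x ^ k • w)
    (hx : ∀ g : G, g • v = v → g * x * g⁻¹ = x ∨ g * x * g⁻¹ = x⁻¹) :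
    (IsPermIso (localAction G v) (cyclicPermGroup n) ∨
      IsPermIso (localAction G v) (dihedralPermGroup n)) ∧
    ((∀ g : G, g • v = v → g * x * g⁻¹ = x) →
      IsPermIso (localAction G v) (cyclicPermGroup n)) := by
  obtain ⟨r, hrR, hr⟩ := exists_mem_localAction hxv
  have hr' : ∀ i, r (e i) = e (i + 1) := by
    intro i
    obtain ⟨k, rfl⟩ := ZMod.intCast_surjective i
    apply Subtype.ext
    rw [hr, he, ← mul_smul, ← zpow_one_add, ← he]
    push_cast
    rw [add_comm]
  have he0 : (e 0 : V) = w := by simpa using he 0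
  have hfix1 : ∀ g : G, g * x * g⁻¹ = x → ∀ σ : Equiv.Perm (Γ.neighborSet v),
      (∀ y, ((σ y : Γ.neighborSet v) : V) = g • (y : V)) → σ (e 0) = e 0 → ∀ i, σ (e i) = e i := by
    intro g hg σ hσ h0 i
    obtain ⟨k, rfl⟩ := ZMod.intCast_surjective i
    have h1 : g • w = w := by rw [← he0, ← hσ, h0]
    apply Subtype.ext
    have h2 : g * x ^ k * g⁻¹ = x ^ k := by rw [← conj_zpow, hg]
    rw [hσ, he, ← mul_smul, mul_inv_eq_iff_eq_mul.1 h2, mul_smul, h1]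
  have hfix2 : ∀ g : G, g * x * g⁻¹ = x⁻¹ → ∀ σ : Equiv.Perm (Γ.neighborSet v),
      (∀ y, ((σ y : Γ.neighborSet v) : V) = g • (y : V)) → σ (e 0) = e 0 →
      ∀ i, σ (e i) = e (-i) := by
    intro g hg σ hσ h0 i
    obtain ⟨k, rfl⟩ := ZMod.intCast_surjective i
    have h1 : g • w = w := by rw [← he0, ← hσ, h0]
    apply Subtype.ext
    have h2 : g * x ^ k * g⁻¹ = x ^ (-k) := by rw [← conj_zpow, hg, inv_zpow']
    rw [hσ, he, ← mul_smul, mul_inv_eq_iff_eq_mul.1 h2, mul_smul, h1, ← he]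
    push_cast
    rfl
  have hall : ∀ σ ∈ localAction G v, σ (e 0) = e 0 →
      (∀ i, σ (e i) = e i) ∨ ∀ i, σ (e i) = e (-i) := by
    intro σ hσ h0
    obtain ⟨g, hg, hgx⟩ := exists_of_mem_localAction hσ
    exact (hx g hg).imp (fun h1 => hfix1 g h1 σ hgx h0) (fun h1 => hfix2 g h1 σ hgx h0)
  constructor
  · by_cases hcyc : ∀ σ ∈ localAction G v, σ (e 0) = e 0 → ∀ i, σ (e i) = e i
    · exact Or.inl (isPermIso_cyclicPermGroup e hrR hr' hcyc)
    · push Not at hcyc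
      obtain ⟨σ, hσ, h0, i, hi⟩ := hcyc
      exact Or.inr (isPermIso_dihedralPermGroup e hrR hr' hall hσ
        ((hall σ hσ h0).resolve_left fun h1 => hi (h1 i)))
  · intro hcomm
    refine isPermIso_cyclicPermGroup e hrR hr' fun σ hσ h0 => ?_
    obtain ⟨g, hg, hgx⟩ := exists_of_mem_localAction hσ
    exact hfix1 g (hcomm g hg) σ hgx h0

end LocalAction

/-! ### Quotient graphs and the covering projection -/

section Quotient

theorem orbitMk_eq_iff {G V : Type*} [Group G] [MulAction G V] {N : Subgroup G} {u v : V} :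
    orbitMk N u = orbitMk N v ↔ ∃ n ∈ N, n • v = u := by
  rw [orbitMk, orbitMk, Quotient.eq]
  exact ⟨fun ⟨n, hn⟩ => ⟨n, n.2, hn⟩, fun ⟨n, hn, h⟩ => ⟨⟨n, hn⟩, h⟩⟩

namespace ActsLocallyQuasiprimitively

variable {G : Type*} [Group G] {V : Type*} [MulAction G V] {Γ : SimpleGraph V}

/-- If the neighbours of `v` are permuted in a cycle of prime length then the orbits of a normal
subgroup meet the neighbourhood in at most one point unless one of them contains it. -/
theorem eq_of_mem_orbit {N : Subgroup G} [N.Normal] {v w w' : V} {d : ℕ}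
    (hd : d.Prime) {x : G} (e : ZMod d ≃ Γ.neighborSet v) (he : ∀ k : ℤ, (e k : V) = x ^ k • w)
    (hN : ¬ ∀ y, Γ.Adj v y → ∃ n ∈ N, n • w = y) (hw' : Γ.Adj v w') {n : G} (hn : n ∈ N)
    (hnw : n • w = w') : w = w' := by
  obtain ⟨i, hi⟩ := e.surjective ⟨w', hw'⟩
  obtain ⟨m, rfl⟩ := ZMod.intCast_surjective i
  have hm : x ^ m • w = w' := by rw [← he, hi]
  by_contra hne
  refine hN ?_
  -- T consists of the elements keeping w inside its N-orbit. It contains x^d and x^m; d does not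
  -- divide m since w' ≠ w, so by Bézout it contains x, and the N-orbit of w is all of Γ(v).
  let T := N ⊔ MulAction.stabilizer G w
  have hTmem : ∀ g ∈ T, ∃ n ∈ N, n • w = g • w := by
    intro g hg
    obtain ⟨n, hn, s, hs, rfl⟩ := Subgroup.mem_sup_of_normal_left.1 hg
    exact ⟨n, hn, by rw [mul_smul, show s • w = w from hs]⟩
  have hxm : x ^ m ∈ T := by
    have h1 : n⁻¹ * x ^ m ∈ T := (le_sup_right : _ ≤ T) (by
      rw [MulAction.mem_stabilizer_iff, mul_smul, hm, ← hnw, inv_smul_smul])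
    simpa using T.mul_mem ((le_sup_left : N ≤ T) hn) h1
  have hxd : x ^ d ∈ T := (le_sup_right : _ ≤ T) (by
    have h1 := he d
    have h0 := he 0
    simp only [Int.cast_natCast, CharP.cast_eq_zero, Int.cast_zero, zpow_zero, one_smul,
      zpow_natCast] at h1 h0
    rw [MulAction.mem_stabilizer_iff, ← h1, h0])
  have hcop : IsCoprime (d : ℤ) m := by
    refine ((Nat.prime_iff_prime_int.1 hd).coprime_iff_not_dvd).2 fun hdm => hne ?_
    rw [← hm, ← he, (ZMod.intCast_zmod_eq_zero_iff_dvd m d).2 hdm]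
    simpa using (he 0).symm
  obtain ⟨a, b, hab⟩ := hcop
  have hx : x ∈ T := by
    have h1 : x = (x ^ d) ^ a * (x ^ m) ^ b := by
      rw [← zpow_natCast, ← zpow_mul, ← zpow_mul, ← zpow_add, mul_comm (d : ℤ), mul_comm m, hab,
        zpow_one]
    rw [h1]
    exact T.mul_mem (T.zpow_mem hxd a) (T.zpow_mem hxm b)
  intro y hy
  obtain ⟨i, hi⟩ := e.surjective ⟨y, hy⟩
  obtain ⟨k, rfl⟩ := ZMod.intCast_surjective i
  obtain ⟨n, hn, hny⟩ := hTmem _ (T.zpow_mem hx k)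
  exact ⟨n, hn, by rw [hny, ← he, hi]⟩

/-- A normal subgroup with at least three orbits has no orbit containing a neighbourhood. -/
theorem not_neighbors_in_orbit (h : ActsLocallyQuasiprimitively G Γ) {N : Subgroup G} [N.Normal]
    (hN : 3 ≤ Nat.card (MulAction.orbitRel.Quotient N V)) {v w : V} (hvw : Γ.Adj v w) :
    ¬ ∀ y, Γ.Adj v y → ∃ n ∈ N, n • w = y := by
  intro hall
  have hsurj : Function.Surjective
      (fun b : Bool => cond b (orbitMk N v) (orbitMk N w)) := by
    intro a
    obtain ⟨u, rfl⟩ := Quotient.mk_surjective a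
    obtain ⟨n, hn, hu | hu⟩ := h.mem_orbit_or_mem_orbit hvw hall u
    · exact ⟨true, (orbitMk_eq_iff.2 ⟨n, hn, hu⟩).symm⟩
    · exact ⟨false, (orbitMk_eq_iff.2 ⟨n, hn, hu⟩).symm⟩
  have h1 := Nat.card_le_card_of_surjective _ hsurj
  rw [Nat.card_eq_fintype_card (α := Bool), Fintype.card_bool] at h1
  omega

theorem isRegularCovering (h : ActsLocallyQuasiprimitively G Γ) {N : Subgroup G} [hN : N.Normal]
    (hcard : 3 ≤ Nat.card (MulAction.orbitRel.Quotient N V))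
    (hinj : ∀ v w w', Γ.Adj v w → Γ.Adj v w' → (∃ n ∈ N, n • w = w') → w = w') :
    IsRegularCovering Γ N := by
  intro v
  refine ⟨fun w hw => ⟨fun hvw => ?_, v, w, rfl, rfl, hw⟩, fun w hw w' hw' hww' => ?_, ?_⟩
  -- If v and w lay in one N-orbit, conjugating by G_v would put every neighbour of v in that orbit.
  · obtain ⟨n, hn, hnw⟩ := orbitMk_eq_iff.1 hvw
    refine h.not_neighbors_in_orbit hcard hw fun y hy => ?_
    obtain ⟨g, hgv, hgw⟩ := h.exists_stabilizer_smul_eq hw hy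
    refine ⟨g * n⁻¹ * g⁻¹ * n, N.mul_mem (hN.conj_mem _ (N.inv_mem hn) g) hn, ?_⟩
    rw [mul_smul, hnw, mul_smul, mul_smul, inv_smul_eq_iff.2 hgv.symm, inv_smul_eq_iff.2 hnw.symm,
      hgw]
  · exact (hinj v w' w hw' hw (orbitMk_eq_iff.1 hww')).symm
  · rintro b ⟨-, x, y, hx, rfl, hxy⟩
    obtain ⟨n, hn, rfl⟩ := orbitMk_eq_iff.1 hx
    refine ⟨n⁻¹ • y, h.adj_of_smul n (by simpa using hxy), ?_⟩
    exact orbitMk_eq_iff.2 ⟨n⁻¹, N.inv_mem hn, rfl⟩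

end ActsLocallyQuasiprimitively

theorem quotientIsArcTransitiveLocally {V : Type*} {Γ : SimpleGraph V} {G : Subgroup (Γ ≃g Γ)}
    {N : Subgroup G} [hN : N.Normal] {Ω : Type*} {L : Subgroup (Equiv.Perm Ω)}
    (h : ActsLocallyQuasiprimitively G Γ) (hGL : IsLocally G L) (hcov : IsRegularCovering Γ N) :
    QuotientIsArcTransitiveLocally G N L := by
  have hmap : ∀ (g : G) (u v : V), orbitMk N u = orbitMk N v →
      orbitMk N (g • u) = orbitMk N (g • v) := by
    intro g u v huv
    obtain ⟨n, hn, rfl⟩ := orbitMk_eq_iff.1 huv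
    refine orbitMk_eq_iff.2 ⟨g * n * g⁻¹, hN.conj_mem n hn g, ?_⟩
    rw [mul_smul, mul_smul, inv_smul_smul]
  let f : G → MulAction.orbitRel.Quotient N V → MulAction.orbitRel.Quotient N V := fun g =>
    Quotient.lift (fun v => orbitMk N (g • v)) fun u v huv => hmap g u v (Quotient.sound huv)
  have hf : ∀ g v, f g (orbitMk N v) = orbitMk N (g • v) := fun _ _ => rfl
  have hmk : ∀ a, ∃ v : V, orbitMk N v = a := fun a => Quotient.mk_surjective a
  have hfmul : ∀ g g' a, f (g * g') a = f g (f g' a) := by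
    intro g g' a
    obtain ⟨v, rfl⟩ := hmk a
    rw [hf, hf, hf, mul_smul]
  have hfone : ∀ a, f 1 a = a := by
    intro a
    obtain ⟨v, rfl⟩ := hmk a
    rw [hf, one_smul]
  have hfadj : ∀ g a b, (orbitGraph Γ N).Adj a b → (orbitGraph Γ N).Adj (f g a) (f g b) := by
    rintro g a b ⟨hab, x, y, rfl, rfl, hxy⟩
    refine ⟨fun h1 => hab ?_, g • x, g • y, rfl, rfl, h.smul_adj g hxy⟩
    have h2 := congrArg (f g⁻¹) h1
    rwa [← hfmul, ← hfmul, inv_mul_cancel, hfone, hfone] at h2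
  let ρ₀ : G →* (orbitGraph Γ N ≃g orbitGraph Γ N) :=
    { toFun := fun g =>
        { toFun := f g
          invFun := f g⁻¹
          left_inv := fun a => by rw [← hfmul, inv_mul_cancel, hfone]
          right_inv := fun a => by rw [← hfmul, mul_inv_cancel, hfone]
          map_rel_iff' := fun {a b} => ⟨fun hab => by
            have h1 := hfadj g⁻¹ _ _ hab
            rwa [Equiv.coe_fn_mk, ← hfmul, ← hfmul, inv_mul_cancel, hfone, hfone] at h1,
            hfadj g a b⟩ }
      map_one' := RelIso.ext hfone
      map_mul' := fun g g' => RelIso.ext (hfmul g g') }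
  have hρ₀ : ∀ g v, ρ₀ g (orbitMk N v) = orbitMk N (g • v) := fun _ _ => rfl
  have hker : N ≤ ρ₀.ker := fun n hn => by
    refine RelIso.ext fun a => ?_
    obtain ⟨v, rfl⟩ := hmk a
    exact orbitMk_eq_iff.2 ⟨n, hn, rfl⟩
  -- An element fixing the orbit of v can be corrected by N to fix v without changing its image.
  -- Faithfulness then follows: a corrected kernel element fixes v and, by local injectivity of the
  -- projection, the neighbours of each of its fixed vertices.
  have hfixv : ∀ (g : G) (v : V), orbitMk N (g • v) = orbitMk N v →
      ∃ g' : G, g' • v = v ∧ ρ₀ g' = ρ₀ g ∧ (g' ∈ N → g ∈ N) := by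
    intro g v hgv
    obtain ⟨n, hn, hnv⟩ := orbitMk_eq_iff.1 hgv
    refine ⟨n⁻¹ * g, by rw [mul_smul, ← hnv, inv_smul_smul], ?_, fun h1 => ?_⟩
    · rw [map_mul, MonoidHom.mem_ker.1 (hker (N.inv_mem hn)), one_mul]
    · simpa using N.mul_mem hn h1
  refine ⟨QuotientGroup.lift N ρ₀ hker, ?_, hρ₀, ?_, ?_⟩
  · rw [injective_iff_map_eq_one]
    intro q hq
    obtain ⟨g, rfl⟩ := QuotientGroup.mk_surjective q
    have hg : ρ₀ g = 1 := hq
    rw [QuotientGroup.eq_one_iff]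
    obtain ⟨v⟩ := h.connected.nonempty
    obtain ⟨g', hg'v, hg', hmem⟩ := hfixv g v (by rw [← hρ₀, hg]; rfl)
    refine hmem ?_
    rw [h.eq_one_of_fixes_neighbors (g := g') (fun u hu w hw => ?_) hg'v]
    · exact N.one_mem
    · have h1 := h.smul_adj g' hw
      rw [hu] at h1
      exact (hcov u).injOn h1 hw (by rw [← hρ₀, hg', hg]; rfl)
  · rintro _ _ _ _ ⟨-, x, y, rfl, rfl, hxy⟩ ⟨-, x', y', rfl, rfl, hxy'⟩
    obtain ⟨g, hgx, hgy⟩ := h.arc_transitive _ _ _ _ hxy hxy'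
    refine ⟨ρ₀ g, ⟨QuotientGroup.mk g, rfl⟩, ?_, ?_⟩
    · exact (hρ₀ g x).trans (congrArg _ hgx)
    · exact (hρ₀ g y).trans (congrArg _ hgy)
  · intro a
    obtain ⟨v, rfl⟩ := hmk a
    refine IsPermIso.trans (IsPermIso.symm ?_) (hGL v)
    let e := (hcov v).equiv
    have he : ∀ y : Γ.neighborSet v, (e y : MulAction.orbitRel.Quotient N V) = orbitMk N (y : V) :=
      fun _ => rfl
    refine ⟨e, fun σ => ⟨fun hσ => ?_, ?_⟩⟩
    · obtain ⟨g, hg, hgx⟩ := exists_of_mem_localAction hσ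
      refine ⟨ρ₀ g, ⟨QuotientGroup.mk g, rfl⟩, ?_, fun b => ?_⟩
      · rw [hρ₀, hg]
      · obtain ⟨y, rfl⟩ := e.surjective b
        rw [Equiv.permCongr_apply, e.symm_apply_apply, he, he, hρ₀, hgx]
    · rintro ⟨_, ⟨q, rfl⟩, hqv, hqx⟩
      obtain ⟨g, rfl⟩ := QuotientGroup.mk_surjective q
      have hgv : ρ₀ g (orbitMk N v) = orbitMk N v := hqv
      obtain ⟨g', hg'v, hg', -⟩ := hfixv g v (by rw [← hρ₀, hgv])
      refine ⟨g', g'.2, hg'v, fun y => ?_⟩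
      have h1 : ((e.permCongr σ (e y) : (orbitGraph Γ N).neighborSet _) :
          MulAction.orbitRel.Quotient N V) = ρ₀ g (e y) := hqx (e y)
      rw [Equiv.permCongr_apply, e.symm_apply_apply, he, he, ← hg', hρ₀] at h1
      have h2 := h.smul_adj g' y.2
      rw [hg'v] at h2
      exact (hcov v).injOn (σ y).2 h2 h1

end Quotient

/-! ### Groups of order p², Sylow arguments and counting -/

theorem nonempty_linearEquiv_of_card_eq_prime_sq {p : ℕ} [Fact p.Prime] {M : Type*}
    [AddCommGroup M] [Module (ZMod p) M] [Finite M] (hM : Nat.card M = p ^ 2) :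
    Nonempty (M ≃ₗ[ZMod p] Fin 2 → ZMod p) := by
  have hrank : Module.finrank (ZMod p) M = 2 := by
    have := Fintype.ofFinite M
    have h1 := Module.card_eq_pow_finrank (K := ZMod p) (V := M)
    rw [ZMod.card, ← Nat.card_eq_fintype_card] at h1
    exact Nat.pow_right_injective (Fact.out : p.Prime).two_le (h1.symm.trans hM)
  exact ⟨(Module.finBasisOfFinrankEq (ZMod p) M hrank).equivFun⟩

theorem nonempty_mulEquiv_of_card_eq_prime_sq {p : ℕ} [Fact p.Prime] {A : Type*} [Group A]
    (hA : Nat.card A = p ^ 2) (hcyc : ¬ IsCyclic A) :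
    Nonempty (A ≃* Multiplicative (Fin 2 → ZMod p)) := by
  have hp : p.Prime := Fact.out
  have : Finite A := Nat.finite_of_card_ne_zero (by rw [hA]; exact pow_ne_zero _ hp.ne_zero)
  have : IsMulCommutative A := IsPGroup.isMulCommutative_of_card_eq_prime_sq hA
  let _ : CommGroup A := IsMulCommutative.instCommGroup
  have hexp : ∀ x : A, x ^ p = 1 := by
    intro x
    obtain ⟨i, hi, hxi⟩ := (Nat.dvd_prime_pow hp).1 (hA ▸ orderOf_dvd_natCard x)
    have hi2 : i ≠ 2 := fun h2 => hcyc (isCyclic_of_orderOf_eq_card x (by rw [hxi, h2, hA]))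
    refine orderOf_dvd_iff_pow_eq_one.1 (hxi ▸ ?_)
    exact (pow_dvd_pow p (by omega : i ≤ 1)).trans (pow_one p).dvd
  let _ : Module (ZMod p) (Additive A) := AddCommGroup.zmodModule fun x => hexp x.toMul
  have hcard : Nat.card (Additive A) = p ^ 2 := hA
  obtain ⟨e⟩ := nonempty_linearEquiv_of_card_eq_prime_sq hcard
  exact ⟨AddEquiv.toMultiplicativeRight e.toAddEquiv⟩

/-- The number of Sylow p-subgroups divides the index, hence is below p, and is congruent to 1
modulo p. -/
theorem Sylow.normal_of_index_lt {p : ℕ} [Fact p.Prime] {G : Type*} [Group G] [Finite G]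
    (P : Sylow p G) (hP : (P : Subgroup G).index < p) : (P : Subgroup G).Normal := by
  have h1 : Nat.card (Sylow p G) < p :=
    (Nat.le_of_dvd (Nat.pos_of_ne_zero Subgroup.index_ne_zero_of_finite) P.card_dvd_index).trans_lt
      hP
  have h2 := (card_sylow_modEq_one p G).eq_of_lt_of_lt h1 (Fact.out : p.Prime).one_lt
  have : Subsingleton (Sylow p G) := (Nat.card_eq_one_iff_unique.1 h2).1
  exact P.normal_of_subsingleton

namespace ActsLocallyQuasiprimitively

variable {G : Type*} [Group G] {V : Type*} [MulAction G V] {Γ : SimpleGraph V}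

/-- Every odd power of an arc-reversing element sends v to w, so it is not the identity. -/
theorem even_card (h : ActsLocallyQuasiprimitively G Γ) : 2 ∣ Nat.card G := by
  obtain ⟨v⟩ := h.connected.nonempty
  obtain ⟨w, hvw⟩ := h.exists_adj v
  obtain ⟨t, htv, htw⟩ := h.exists_swap hvw
  by_contra hodd
  obtain ⟨j, hj⟩ := Nat.odd_iff.2 (Nat.two_dvd_ne_zero.1 hodd)
  have h1 : t ^ 2 ∈ MulAction.stabilizer G v := by
    rw [MulAction.mem_stabilizer_iff, pow_two, mul_smul, htv, htw]
  have h2 : (t ^ 2) ^ j • v = v := Subgroup.pow_mem _ h1 j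
  have h3 : t ^ Nat.card G = 1 := pow_card_eq_one'
  have h4 : t ^ Nat.card G • v = w := by
    rw [hj, pow_succ', pow_mul, mul_smul, h2, htv]
  rw [h3, one_smul] at h4
  exact hvw.ne h4

theorem card_neighborSet_le_card_stabilizer [Finite G] (h : ActsLocallyQuasiprimitively G Γ) (v : V) :
    Nat.card (Γ.neighborSet v) ≤ Nat.card (MulAction.stabilizer G v) := by
  obtain ⟨w, hvw⟩ := h.exists_adj v
  refine Nat.card_le_card_of_surjective (fun g : MulAction.stabilizer G v =>
    (⟨(g : G) • w, by
      have h1 := h.smul_adj (g : G) hvw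
      rwa [show (g : G) • v = v from g.2] at h1⟩ : Γ.neighborSet v)) ?_
  rintro ⟨y, hy⟩
  obtain ⟨g, hg, hgy⟩ := h.exists_stabilizer_smul_eq hvw hy
  exact ⟨⟨g, hg⟩, Subtype.ext hgy⟩

theorem card_eq_card_mul_card_stabilizer (h : ActsLocallyQuasiprimitively G Γ) (v : V) :
    Nat.card G = Nat.card V * Nat.card (MulAction.stabilizer G v) := by
  have : MulAction.IsPretransitive G V := ⟨h.exists_smul_eq⟩
  rw [← MulAction.index_stabilizer_of_transitive G v, mul_comm, Subgroup.card_mul_index]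

end ActsLocallyQuasiprimitively

theorem Sylow.card_eq_of_card_eq_pow_mul {p : ℕ} [Fact p.Prime] {G : Type*} [Group G] [Finite G]
    (P : Sylow p G) {n m : ℕ} (hG : Nat.card G = p ^ n * m) (hm : ¬ p ∣ m) :
    Nat.card (P : Subgroup G) = p ^ n ∧ (P : Subgroup G).index = m := by
  have hp : p.Prime := Fact.out
  have h1 : Nat.card (P : Subgroup G) = p ^ n := by
    rw [P.card_eq_multiplicity, hG, Nat.factorization_mul (pow_ne_zero _ hp.ne_zero)
      (by rintro rfl; exact hm (dvd_zero p)), hp.factorization_pow, Finsupp.add_apply,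
      Nat.factorization_eq_zero_of_not_dvd hm, Finsupp.single_eq_same, add_zero]
  refine ⟨h1, ?_⟩
  have h2 := (P : Subgroup G).card_mul_index
  rw [h1, hG] at h2
  exact Nat.eq_of_mul_eq_mul_left (pow_pos hp.pos n) h2

theorem card_orbitRelQuotient_of_semiregular {H V : Type*} [Group H] [Finite H] [MulAction H V]
    (h : ∀ v : V, MulAction.stabilizer H v = ⊥) {k : ℕ} (hV : Nat.card V = k * Nat.card H) :
    Nat.card (MulAction.orbitRel.Quotient H V) = k := by
  have h1 := Nat.card_congr (MulAction.selfEquivOrbitsQuotientProd h)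
  rw [Nat.card_prod, hV] at h1
  exact (Nat.eq_of_mul_eq_mul_right Nat.card_pos h1).symm

/-! ### Assembly of the theorem -/

theorem theorem1p2 {Ω : Type w} (L : Subgroup (Equiv.Perm Ω)) (d : ℕ) (hΩ : Nat.card Ω = d)
    (hd : 3 ≤ d) (hL : MulAction.IsQuasiPreprimitive L Ω)
    (c : ℕ) (hc : IsGraphRestrictiveWith.{u} L c)
    (k : ℕ) (hk : 0 < k) (p : ℕ) (hp : p.Prime) (hpc : k * c ≤ p)
    (α : ℕ) (hα : α = 1 ∨ α = 2)
    {V : Type u} [Finite V] (Γ : SimpleGraph V) (hΓ : Γ.Connected)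
    (hV : Nat.card V = k * p ^ α)
    (G : Subgroup (Γ ≃g Γ)) (hG : IsArcTransitive G) (hGL : IsLocally G L)
    (P : Sylow p G) :
    ∃ _ : (P : Subgroup G).Normal,
      -- (a)
      (Nat.card (P : Subgroup G) = p ^ α ∧
        ∀ v : V, MulAction.stabilizer (P : Subgroup G) v = ⊥) ∧
      -- (b)
      (3 ≤ k →
        IsRegularCovering Γ (P : Subgroup G) ∧
        Nat.card (MulAction.orbitRel.Quotient (P : Subgroup G) V) = k ∧
        QuotientIsArcTransitiveLocally G (P : Subgroup G) L) ∧
      -- (c)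
      (∀ v : V, ∃ f : MulAction.stabilizer G v →* MulAut (P : Subgroup G),
        Function.Injective f) ∧
      -- (d)
      (d.Prime ∧
        ((IsCyclic (P : Subgroup G) ∧ p ≡ 1 [MOD 2 * d] ∧
            (∀ v : V, IsPermIso (localAction G v) (cyclicPermGroup d)) ∧
            Nat.card (G ⧸ (P : Subgroup G)) = k * d ∧
            Nonempty (Abelianization (G ⧸ (P : Subgroup G)) ≃* Multiplicative (ZMod (2 * d)))) ∨
          (α = 2 ∧
            Nonempty ((P : Subgroup G) ≃* Multiplicative (ZMod p × ZMod p)) ∧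
            ((∀ v : V, IsPermIso (localAction G v) (cyclicPermGroup d)) ∨
              (∀ v : V, IsPermIso (localAction G v) (dihedralPermGroup d)))))) := by
  have hpf : Fact p.Prime := ⟨hp⟩
  have hΩfin : Finite Ω := Nat.finite_of_card_ne_zero (by omega)
  have hΩne : Nonempty Ω := (Nat.card_pos_iff.1 (by omega : 0 < Nat.card Ω)).1
  have hGfin : Finite G := by
    have : Finite (Γ ≃g Γ) := DFunLike.finite _
    infer_instance
  have h : ActsLocallyQuasiprimitively G Γ :=
    actsLocallyQuasiprimitively_of_isLocally hΓ hG hL hGL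
  have hdeg : ∀ v : V, Nat.card (Γ.neighborSet v) = d := fun v => by
    obtain ⟨e, -⟩ := hGL v
    rw [Nat.card_congr e, hΩ]
  obtain ⟨v₀⟩ := hΓ.nonempty
  have hsd : ∀ v : V, d ≤ Nat.card (MulAction.stabilizer G v) := fun v =>
    hdeg v ▸ h.card_neighborSet_le_card_stabilizer v
  have hGcard : ∀ v : V, Nat.card G = p ^ α * (k * Nat.card (MulAction.stabilizer G v)) := fun v => by
    rw [h.card_eq_card_mul_card_stabilizer v, hV]
    ring
  have hle : ∀ v : V, k * Nat.card (MulAction.stabilizer G v) ≤ p := fun v =>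
    (Nat.mul_le_mul_left k (hc.2 V Γ hΓ G hG hGL v)).trans hpc
  have hs_le : ∀ v : V, Nat.card (MulAction.stabilizer G v) ≤ k * Nat.card (MulAction.stabilizer G v) :=
    fun v => Nat.le_mul_of_pos_left _ hk
  have hp3 : 3 ≤ p := hd.trans ((hsd v₀).trans ((hs_le v₀).trans (hle v₀)))
  -- Equality would give |G| = p^(α+1), which is odd.
  have hlt : ∀ v : V, k * Nat.card (MulAction.stabilizer G v) < p := fun v => by
    refine lt_of_le_of_ne (hle v) fun heq => ?_
    have h1 := h.even_card
    rw [hGcard v, heq, ← pow_succ] at h1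
    have h2 := (Nat.prime_dvd_prime_iff_eq Nat.prime_two hp).1 (Nat.prime_two.dvd_of_dvd_pow h1)
    omega
  have hndvd : ∀ v : V, ¬ p ∣ k * Nat.card (MulAction.stabilizer G v) := fun v =>
    Nat.not_dvd_of_pos_of_lt (Nat.mul_pos hk Nat.card_pos) (hlt v)
  have hndvd' : ∀ v : V, ¬ p ∣ Nat.card (MulAction.stabilizer G v) := fun v hdvd =>
    hndvd v (hdvd.mul_left k)
  obtain ⟨hPcard, hPindex⟩ := P.card_eq_of_card_eq_pow_mul (hGcard v₀) (hndvd v₀)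
  have hPn : (P : Subgroup G).Normal := P.normal_of_index_lt (hPindex ▸ hlt v₀)
  have hsemi : ∀ x ∈ (P : Subgroup G), ∀ v : V, x • v = v → x = 1 := by
    intro x hx v hxv
    have h1 : orderOf x ∣ p ^ α := hPcard ▸ Subgroup.orderOf_dvd_natCard _ hx
    have h2 : orderOf x ∣ Nat.card (MulAction.stabilizer G v) :=
      Subgroup.orderOf_dvd_natCard _ hxv
    have h3 : (p ^ α).Coprime (Nat.card (MulAction.stabilizer G v)) :=
      Nat.Coprime.pow_left _ ((Nat.Prime.coprime_iff_not_dvd hp).2 (hndvd' v))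
    exact orderOf_eq_one_iff.1 (Nat.eq_one_of_dvd_coprimes h3 h1 h2)
  have hstab : ∀ v : V, MulAction.stabilizer (P : Subgroup G) v = ⊥ := fun v => by
    rw [eq_bot_iff]
    exact fun x hx => Subtype.ext (hsemi x x.2 v hx)
  have hcop : (Nat.card (P : Subgroup G)).Coprime (P : Subgroup G).index := by
    rw [hPcard, hPindex]
    exact Nat.Coprime.pow_left _ ((Nat.Prime.coprime_iff_not_dvd hp).2 (hndvd v₀))
  have hp2 : p ≠ 2 := by omega
  have hodd : Odd (Nat.card (P : Subgroup G)) := hPcard ▸ (hp.odd_of_ne_two hp2).pow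
  have hα0 : α ≠ 0 := by omega
  have hne : (P : Subgroup G) ≠ ⊥ := fun h0 => by
    rw [h0, Subgroup.card_bot] at hPcard
    exact (Nat.one_lt_pow hα0 hp.one_lt).ne hPcard
  have hPcyc : ¬ IsCyclic (P : Subgroup G) → α = 2 := fun hnc => hα.resolve_left fun h1 =>
    hnc (isCyclic_of_prime_card (p := p) (by rw [hPcard, h1, pow_one]))
  have hPcomm : IsMulCommutative (P : Subgroup G) := by
    by_cases hcyc : IsCyclic (P : Subgroup G)
    · infer_instance
    · exact IsPGroup.isMulCommutative_of_card_eq_prime_sq (p := p) (by rw [hPcard, hPcyc hcyc])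
  have hscop : ∀ v : V, (Nat.card (MulAction.stabilizer G v)).Coprime p := fun v =>
    ((Nat.Prime.coprime_iff_not_dvd hp).2 (hndvd' v)).symm
  have hnbrs : ∀ v : V, ∃ w w', Γ.Adj v w ∧ Γ.Adj v w' ∧ w ≠ w' := fun v => by
    have : Nontrivial (Γ.neighborSet v) := by
      rw [← Finite.one_lt_card_iff_nontrivial, hdeg v]
      omega
    obtain ⟨a, b, hab⟩ := exists_pair_ne (Γ.neighborSet v)
    exact ⟨a, b, a.2, b.2, fun h1 => hab (Subtype.ext h1)⟩
  have hcyclic : IsCyclic (P : Subgroup G) → ∀ (v : V) (a b : G), a • v = v → b • v = v →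
      a * b = b * a := fun _ => h.commute_of_isCyclic hcop hodd hne hsemi
  have hrot : ∀ v w, Γ.Adj v w → ∃ x : G, x • v = v ∧ x • w ≠ w ∧
      ∀ g : G, g • v = v → g * x * g⁻¹ = x ∨ g * x * g⁻¹ = x⁻¹ := by
    intro v w hvw
    obtain ⟨w', hvw', hww'⟩ : ∃ w', Γ.Adj v w' ∧ w ≠ w' := by
      obtain ⟨a, b, ha, hb, hab⟩ := hnbrs v
      by_cases hwa : w = a
      · exact ⟨b, hb, hwa ▸ hab⟩
      · exact ⟨a, ha, hwa⟩
    by_cases hcyc : IsCyclic (P : Subgroup G)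
    · obtain ⟨x, hxv, hxw⟩ := h.exists_stabilizer_smul_eq hvw hvw'
      refine ⟨x, hxv, hxw ▸ hww'.symm, fun g hg => Or.inl ?_⟩
      rw [hcyclic hcyc v g x hg hxv, mul_inv_cancel_right]
    · obtain ⟨f⟩ := nonempty_mulEquiv_of_card_eq_prime_sq (p := p) (by rw [hPcard, hPcyc hcyc]) hcyc
      exact h.exists_conj_eq_or_eq_inv_of_rank_two hcop hodd hne hsemi hp2 (hscop v) f hvw hvw' hww'
  have hcycle : ∀ v w, Γ.Adj v w → d.Prime ∧ ∃ (x : G) (e : ZMod d ≃ Γ.neighborSet v),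
      x • v = v ∧ (∀ k : ℤ, (e k : V) = x ^ k • w) ∧
      ∀ g : G, g • v = v → g * x * g⁻¹ = x ∨ g * x * g⁻¹ = x⁻¹ := by
    intro v w hvw
    obtain ⟨x, hxv, hxw, hx⟩ := hrot v w hvw
    have h1 := h.exists_cycle hvw hxv hxw hx
    rw [hdeg v] at h1
    obtain ⟨hdp, e, he⟩ := h1
    exact ⟨hdp, x, e, hxv, he, hx⟩
  obtain ⟨w₀, -, hvw₀, -, -⟩ := hnbrs v₀
  obtain ⟨hdp, x₀, e₀, hx₀v, he₀, hx₀⟩ := hcycle v₀ w₀ hvw₀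
  have hlocal := isPermIso_localAction_cyclic_or_dihedral hx₀v e₀ he₀ hx₀
  have htransfer : ∀ v : V, IsPermIso (localAction G v) (localAction G v₀) := fun v =>
    (hGL v).trans (hGL v₀).symm
  refine ⟨hPn, ⟨hPcard, hstab⟩, fun hk3 => ?_, fun v => ?_, hdp, ?_⟩
  · have hquot : Nat.card (MulAction.orbitRel.Quotient (P : Subgroup G) V) = k :=
      card_orbitRelQuotient_of_semiregular hstab (by rw [hV, hPcard])
    have hcov : IsRegularCovering Γ (P : Subgroup G) := by
      refine h.isRegularCovering (by rw [hquot]; exact hk3) ?_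
      rintro v w w' hw hw' ⟨n, hn, hnw⟩
      obtain ⟨-, x, e, -, he, -⟩ := hcycle v w hw
      exact ActsLocallyQuasiprimitively.eq_of_mem_orbit hdp e he
        (h.not_neighbors_in_orbit (by rw [hquot]; exact hk3) hw) hw' hn hnw
    exact ⟨hcov, hquot, quotientIsArcTransitiveLocally h hGL hcov⟩
  · refine ⟨MulAut.conjNormal.comp (MulAction.stabilizer G v).subtype, ?_⟩
    rw [injective_iff_map_eq_one]
    exact fun g hg => Subtype.ext (h.eq_one_of_centralizes hcop hodd hne hsemi g.2 hg)
  · by_cases hcyc : IsCyclic (P : Subgroup G)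
    · left
      have hloc : ∀ v : V, IsPermIso (localAction G v) (cyclicPermGroup d) := fun v =>
        (htransfer v).trans (hlocal.2 fun g hg => by
          rw [hcyclic hcyc v₀ g x₀ hg hx₀v, mul_inv_cancel_right])
      obtain ⟨hcard, hdvd, hab⟩ := h.abelianization_quotient_of_isCyclic hcop hodd hne hsemi hdp
        (hdp.odd_of_ne_two (by omega)) (hdeg v₀)
      refine ⟨hcyc, ?_, hloc, ?_, hab⟩
      · rw [hPcard, Nat.totient_prime_pow hp (Nat.pos_of_ne_zero hα0)] at hdvd
        -- 2d divides φ(p^α) = p^(α−1)(p − 1), and the first factor drops out because d = |G_v| is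
        -- prime to p.
        have hcop2 : (2 * d).Coprime (p ^ (α - 1)) := by
          refine Nat.Coprime.pow_right _ (Nat.Coprime.mul_left ?_ (hcard ▸ hscop v₀))
          exact (Nat.coprime_primes Nat.prime_two hp).2 hp2.symm
        exact ((Nat.modEq_iff_dvd' hp.one_lt.le).2 (hcop2.dvd_of_dvd_mul_left hdvd)).symm
      · rw [← Subgroup.index_eq_card, hPindex, hcard]
    · right
      obtain ⟨f⟩ := nonempty_mulEquiv_of_card_eq_prime_sq (p := p) (by rw [hPcard, hPcyc hcyc]) hcyc
      refine ⟨hPcyc hcyc,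
        ⟨f.trans (LinearEquiv.finTwoArrow (ZMod p) (ZMod p)).toAddEquiv.toMultiplicative⟩, ?_⟩
      exact hlocal.1.imp (fun h1 v => (htransfer v).trans h1) (fun h1 v => (htransfer v).trans h1)
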